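/- Let $k$ be a field, let $H$ be a finite-dimensional Hopf algebra over $k$ with counit $\varepsilon$ and comultiplication $\Delta(h)=\sum h_1\otimes h_2$, and let $\Lambda\in H$ be a nonzero left integral, that is, $\Lambda\neq 0$ and $h\Lambda=\varepsilon(h)\Lambda$ for all $h\in H$. Let $R$ be a left $H$-module algebra, that is, a $k$-algebra that is also a left $H$-module (with the same $k$-vector space structure) such that $h\cdot 1=\varepsilon(h)1$ and $h\cdot(ab)=\sum(h_1\cdot a)(h_2\cdot b)$ for all $h\in H$ and $a,b\in R$. Put $R^H=\{r\in R\mid h\cdot r=\varepsilon(h)r \text{ for all } h\in H\}$, a subalgebra of $R$ that contains $\Lambda R=\{\Lambda\cdot r\mid r\in R\}$, and let $T=R\#H$ be the smash product: the $k$-vector space $R\otimes_k H$ with the multiplication $(r\#h)(r'\#h')=\sum r(h_1\cdot r')\#h_2h'$. Assume that $R$ is noetherian as a left $R^H$-module (so that $T$ is left noetherian) and that $R^H/\Lambda R$ is finite-dimensional over $k$. Let $G_0(T)$ be the Grothendieck group of the category of finitely generated left $T$-modules: the abelian group generated by the classes $[V]$ of finitely generated left $T$-modules $V$, with a relation $[V]=[U]+[W]$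 for every short exact sequence $0\to U\to V\to W\to 0$. Let $\delta$ be the greatest common divisor of the dimensions over $k$ of all finitely generated projective left $H$-modules. Then for every left $T$-module $M$ with $\dim_k M<\infty$, the order of $[M]$ in $G_0(T)$ is divisible by $\delta/\gcd(\delta,\dim_k M)$, where it is understood that every integer divides $\infty$. -/

import Mathlib

open scoped TensorProduct

universe uk uR uH uA

/-! ## Module algebras -/

/-- The `k`-linear map `H → R`, `h ↦ h • a`, for an `H`-module `R` over a `k`-algebra `H`. -/
noncomputable def actOn (k : Type uk) (H : Type uH) {R : Type uR} [Field k] [Ring H] [Algebra k H]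
    [AddCommGroup R] [Module k R] [Module H R] [IsScalarTower k H R] (a : R) : H →ₗ[k] R :=
  (Algebra.lsmul k k R : H →ₐ[k] Module.End k R).toLinearMap.flip a

@[simp]
theorem actOn_apply (k : Type uk) (H : Type uH) {R : Type uR} [Field k] [Ring H] [Algebra k H]
    [AddCommGroup R] [Module k R] [Module H R] [IsScalarTower k H R] (a : R) (h : H) :
    actOn k H a h = h • a := rfl

/-- `R` is a left `H`-module algebra: `R` is a `k`-algebra and a left `H`-module (with the same
underlying `k`-vector space) such that `h • 1 = ε(h) 1` and `h • (a b) = ∑ (h₁ • a) (h₂ • b)`. -/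
class HModuleAlgebra (k : Type uk) (H : Type uH) (R : Type uR) [Field k] [Ring H] [Bialgebra k H]
    [Ring R] [Algebra k R] [Module H R] [IsScalarTower k H R] : Prop where
  smul_one' : ∀ h : H, h • (1 : R) = (Coalgebra.counit h : k) • (1 : R)
  smul_mul' : ∀ (h : H) (a b : R), h • (a * b) =
    LinearMap.mul' k R (TensorProduct.map (actOn k H a) (actOn k H b) (Coalgebra.comul h))

theorem HModuleAlgebra.smul_mul_repr {k : Type uk} {H : Type uH} {R : Type uR} [Field k] [Ring H]
    [Bialgebra k H] [Ring R] [Algebra k R] [Module H R] [IsScalarTower k H R]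
    [HModuleAlgebra k H R] {ι : Type*} {h : H} (ρ : Coalgebra.Repr k h ι) (a b : R) :
    h • (a * b) = ∑ i ∈ ρ.index, (ρ.left i • a) * (ρ.right i • b) := by
  rw [HModuleAlgebra.smul_mul' (k := k), ← ρ.eq]
  simp [map_sum]

/-- The subalgebra `R^H = {r | h • r = ε(h) r for all h}` of `H`-invariants of `R`. -/
def HInvariants (k : Type uk) (H : Type uH) (R : Type uR) [Field k] [Ring H] [Bialgebra k H]
    [Ring R] [Algebra k R] [Module H R] [IsScalarTower k H R] [HModuleAlgebra k H R] :
    Subalgebra k R where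
  carrier := {r | ∀ h : H, h • r = (Coalgebra.counit h : k) • r}
  mul_mem' := by
    intro a b ha hb h
    have ρ := Coalgebra.Repr.arbitrary k h
    rw [HModuleAlgebra.smul_mul_repr ρ]
    have := congrArg (Coalgebra.counit (R := k)) (Coalgebra.sum_counit_smul ρ)
    rw [← this]
    simp only [ha _, hb _, map_sum, map_smul, smul_eq_mul, Finset.sum_smul, smul_mul_smul_comm]
  add_mem' := by
    intro a b ha hb h
    rw [smul_add, smul_add, ha h, hb h]
  algebraMap_mem' := by
    intro c h
    rw [Algebra.algebraMap_eq_smul_one, smul_comm h c (1 : R), HModuleAlgebra.smul_one' (k := k),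
      smul_comm]

/-- `Λ` is a left integral of `H`: `h Λ = ε(h) Λ` for all `h`. -/
def IsLeftIntegral (k : Type uk) {H : Type uH} [Field k] [Ring H] [Bialgebra k H] (Λ : H) : Prop :=
  ∀ h : H, h * Λ = (Coalgebra.counit h : k) • Λ

/-- The `k`-subspace `Λ R = {Λ • r | r ∈ R}` of `R`. -/
noncomputable def smulImage (k : Type uk) {H : Type uH} (R : Type uR) [Field k] [Ring H]
    [Algebra k H] [AddCommGroup R] [Module k R] [Module H R] [IsScalarTower k H R] (Λ : H) :
    Submodule k R :=
  LinearMap.range (Algebra.lsmul k k R Λ)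

theorem smulImage_le_HInvariants {k : Type uk} {H : Type uH} {R : Type uR} [Field k] [Ring H]
    [Bialgebra k H] [Ring R] [Algebra k R] [Module H R] [IsScalarTower k H R]
    [HModuleAlgebra k H R] {Λ : H} (hΛ : IsLeftIntegral k Λ) :
    smulImage k R Λ ≤ Subalgebra.toSubmodule (HInvariants k H R) := by
  rintro _ ⟨r, rfl⟩ h
  change h • Λ • r = (Coalgebra.counit h : k) • Λ • r
  rw [← mul_smul, hΛ h, smul_assoc]

/-- The quotient space `R^H / Λ R`. -/
abbrev InvariantsModImage (k : Type uk) {H : Type uH} (R : Type uR) [Field k] [Ring H]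
    [Bialgebra k H] [Ring R] [Algebra k R] [Module H R] [IsScalarTower k H R]
    [HModuleAlgebra k H R] (Λ : H) : Type uR :=
  Subalgebra.toSubmodule (HInvariants k H R) ⧸
    (smulImage k R Λ).submoduleOf (Subalgebra.toSubmodule (HInvariants k H R))

/-! ## Smash products -/

/-- The smash product `R # H`; its underlying `k`-vector space is `R ⊗ H`. -/
def SmashProduct (k : Type uk) (R : Type uR) (H : Type uH) [Field k] [Ring H] [Bialgebra k H]
    [Ring R] [Algebra k R] : Type (max uR uH) :=
  R ⊗[k] H

namespace SmashProduct

variable {k : Type uk} {R : Type uR} {H : Type uH} [Field k] [Ring H] [Bialgebra k H]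
  [Ring R] [Algebra k R]

noncomputable instance : AddCommGroup (SmashProduct k R H) :=
  inferInstanceAs (AddCommGroup (R ⊗[k] H))

noncomputable instance : Module k (SmashProduct k R H) :=
  inferInstanceAs (Module k (R ⊗[k] H))

/-- The element `r # h` of `R # H`. -/
def mk (r : R) (h : H) : SmashProduct k R H := r ⊗ₜ[k] h

/-- The linear map `R ⊗ H → R ⊗ H`, `r' ⊗ h' ↦ r r' ⊗ h' h`. -/
noncomputable def sandwich (r : R) (h : H) : R ⊗[k] H →ₗ[k] R ⊗[k] H :=
  TensorProduct.map (LinearMap.mul k R r) ((LinearMap.mul k H).flip h)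

theorem sandwich_tmul (r r' : R) (h h' : H) :
    sandwich (k := k) r h (r' ⊗ₜ[k] h') = (r * r') ⊗ₜ[k] (h' * h) := by
  simp [sandwich]

variable [Module H R] [IsScalarTower k H R]

/-- The linear map `H → R ⊗ H`, `h ↦ ∑ (h₁ • a) ⊗ h₂`. -/
noncomputable def twist (a : R) : H →ₗ[k] R ⊗[k] H :=
  (TensorProduct.map (actOn k H a) LinearMap.id) ∘ₗ Coalgebra.comul

theorem twist_repr {ι : Type*} {h : H} (ρ : Coalgebra.Repr k h ι) (a : R) :
    twist (k := k) a h = ∑ i ∈ ρ.index, (ρ.left i • a) ⊗ₜ[k] ρ.right i := by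
  rw [twist, LinearMap.comp_apply, ← ρ.eq]
  simp [map_sum]

theorem twist_add (a b : R) :
    twist (k := k) (H := H) (a + b) = twist a + twist b := by
  ext h
  have ρ := Coalgebra.Repr.arbitrary k h
  simp [twist_repr ρ, TensorProduct.add_tmul, Finset.sum_add_distrib]

theorem twist_smul (c : k) (a : R) :
    twist (k := k) (H := H) (c • a) = c • twist a := by
  ext h
  have ρ := Coalgebra.Repr.arbitrary k h
  simp only [twist_repr ρ, LinearMap.smul_apply, Finset.smul_sum, TensorProduct.smul_tmul']
  simp only [smul_comm _ c a]

/-- The multiplication of `R # H` as a bilinear map: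
`(r ⊗ h) (r' ⊗ h') = ∑ r (h₁ • r') ⊗ h₂ h'`. -/
noncomputable def mulMap : R ⊗[k] H →ₗ[k] R ⊗[k] H →ₗ[k] R ⊗[k] H :=
  TensorProduct.lift <| LinearMap.mk₂ k
    (fun r h => TensorProduct.lift <| LinearMap.mk₂ k
      (fun r' h' => sandwich r h' (twist r' h))
      (by intro a b c; simp [twist_add])
      (by intro a b c; simp [twist_smul])
      (by intro a b c; simp [sandwich, TensorProduct.map_add_right])
      (by intro a b c; simp [sandwich, TensorProduct.map_smul_right]))
    (by intro a b c; ext; simp [sandwich, TensorProduct.map_add_left])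
    (by intro a b c; ext; simp [sandwich, TensorProduct.map_smul_left])
    (by intro a b c; ext; simp; rfl)
    (by intro a b c; ext; simp; rfl)

theorem mulMap_tmul (r r' : R) (h h' : H) :
    mulMap (r ⊗ₜ[k] h) (r' ⊗ₜ[k] h') = sandwich r h' (twist r' h) := by
  simp [mulMap]; rfl

theorem mulMap_tmul_repr (r r' : R) (h h' : H) {ι : Type*} (ρ : Coalgebra.Repr k h ι) :
    mulMap (r ⊗ₜ[k] h) (r' ⊗ₜ[k] h') =
      ∑ i ∈ ρ.index, (r * (ρ.left i • r')) ⊗ₜ[k] (ρ.right i * h') := by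
  rw [mulMap_tmul, twist_repr ρ, map_sum]
  simp only [sandwich_tmul]

theorem mulMap_sandwich_left (r : R) (x y : R ⊗[k] H) :
    mulMap (sandwich r 1 x) y = sandwich r 1 (mulMap x y) := by
  induction x with
  | zero => simp
  | add a b ha hb => simp [ha, hb]
  | tmul a h =>
    induction y with
    | zero => simp
    | add a b ha hb => simp [ha, hb]
    | tmul b h' =>
      have ρ := Coalgebra.Repr.arbitrary k h
      simp only [sandwich_tmul, mulMap_tmul_repr _ _ _ _ ρ, map_sum, mul_one, mul_assoc]

theorem mulMap_sandwich_right (h : H) (x y : R ⊗[k] H) :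
    mulMap x (sandwich 1 h y) = sandwich 1 h (mulMap x y) := by
  induction x with
  | zero => simp
  | add a b ha hb => simp [ha, hb]
  | tmul a g =>
    induction y with
    | zero => simp
    | add a b ha hb => simp [ha, hb]
    | tmul b h' =>
      have ρ := Coalgebra.Repr.arbitrary k g
      simp only [sandwich_tmul, mulMap_tmul_repr _ _ _ _ ρ, map_sum, one_mul, mul_assoc]

theorem twist_algebra_mul [HModuleAlgebra k H R] (h : H) (a b : R) {ι : Type*}
    (ρ : Coalgebra.Repr k h ι) :
    twist (k := k) (a * b) h = ∑ i ∈ ρ.index, sandwich (ρ.left i • a) 1 (twist b (ρ.right i)) := by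
  let Φ : H ⊗[k] (H ⊗[k] H) →ₗ[k] R ⊗[k] H :=
    TensorProduct.map (LinearMap.mul' k R ∘ₗ TensorProduct.map (actOn k H a) (actOn k H b))
      LinearMap.id ∘ₗ (TensorProduct.assoc k H H H).symm.toLinearMap
  have key := congrArg Φ (Coalgebra.sum_tmul_tmul_eq ρ
    (fun i => Coalgebra.Repr.arbitrary k (ρ.left i))
    (fun i => Coalgebra.Repr.arbitrary k (ρ.right i)))
  simp only [Φ, map_sum, LinearMap.comp_apply, LinearEquiv.coe_coe, TensorProduct.assoc_symm_tmul,
    TensorProduct.map_tmul, LinearMap.mul'_apply, actOn_apply, LinearMap.id_apply] at key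
  rw [twist_repr ρ]
  simp only [twist_repr (Coalgebra.Repr.arbitrary k (ρ.right _)), map_sum, sandwich_tmul, mul_one]
  rw [← key]
  refine Finset.sum_congr rfl fun i _ => ?_
  rw [HModuleAlgebra.smul_mul_repr (Coalgebra.Repr.arbitrary k (ρ.left i)), TensorProduct.sum_tmul]

theorem twist_mul (g h : H) (b : R) {ι : Type*} (ρ : Coalgebra.Repr k h ι) :
    twist (k := k) b (g * h) =
      ∑ i ∈ ρ.index, sandwich 1 (ρ.right i) (twist (ρ.left i • b) g) := by
  have σ := Coalgebra.Repr.arbitrary k g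
  simp only [twist_repr σ, map_sum, sandwich_tmul, one_mul]
  rw [twist, LinearMap.comp_apply, Bialgebra.comul_mul, ← ρ.eq, ← σ.eq, Finset.sum_mul_sum,
    Finset.sum_comm]
  simp [map_sum, mul_smul]

theorem mulMap_assoc [HModuleAlgebra k H R] (x y z : R ⊗[k] H) :
    mulMap (mulMap x y) z = mulMap x (mulMap y z) := by
  induction x with
  | zero => simp
  | add a b ha hb => simp [ha, hb]
  | tmul r g =>
    induction y with
    | zero => simp
    | add a b ha hb => simp [ha, hb]
    | tmul s h =>
      induction z with
      | zero => simp
      | add a b ha hb => simp [ha, hb]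
      | tmul t l =>
        have ρ := Coalgebra.Repr.arbitrary k g
        have σ := Coalgebra.Repr.arbitrary k h
        rw [mulMap_tmul_repr _ _ _ _ ρ, mulMap_tmul_repr _ _ _ _ σ]
        simp only [map_sum, LinearMap.sum_apply, mulMap_tmul]
        simp only [twist_mul _ _ _ σ, twist_algebra_mul g _ _ ρ, map_sum]
        rw [Finset.sum_comm]
        refine Finset.sum_congr rfl fun j _ => Finset.sum_congr rfl fun i _ => ?_
        generalize twist (k := k) (σ.left j • t) (ρ.right i) = w
        induction w with
        | zero => simp
        | add a b ha hb => simp [ha, hb]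
        | tmul u v => simp only [sandwich_tmul, one_mul, mul_one, mul_assoc]

theorem mulMap_one_left [HModuleAlgebra k H R] (x : R ⊗[k] H) :
    mulMap ((1 : R) ⊗ₜ[k] (1 : H)) x = x := by
  induction x with
  | zero => simp
  | add a b ha hb => simp [ha, hb]
  | tmul r h =>
    rw [mulMap_tmul, twist, LinearMap.comp_apply, Bialgebra.comul_one,
      Algebra.TensorProduct.one_def, TensorProduct.map_tmul, sandwich_tmul]
    simp

theorem mulMap_one_right [HModuleAlgebra k H R] (x : R ⊗[k] H) :
    mulMap x ((1 : R) ⊗ₜ[k] (1 : H)) = x := by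
  induction x with
  | zero => simp
  | add a b ha hb => simp [ha, hb]
  | tmul r h =>
    have ρ := Coalgebra.Repr.arbitrary k h
    rw [mulMap_tmul_repr _ _ _ _ ρ]
    simp only [HModuleAlgebra.smul_one' (k := k), mul_one, mul_smul_comm, TensorProduct.smul_tmul,
      ← TensorProduct.tmul_sum, Coalgebra.sum_counit_smul]

variable [HModuleAlgebra k H R]

noncomputable instance : Ring (SmashProduct k R H) where
  mul x y := mulMap (k := k) (R := R) (H := H) x y
  one := mk 1 1
  mul_assoc := mulMap_assoc (k := k) (R := R) (H := H)
  one_mul := mulMap_one_left (k := k) (R := R) (H := H)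
  mul_one := mulMap_one_right (k := k) (R := R) (H := H)
  left_distrib x y z := (mulMap (k := k) (R := R) (H := H) x).map_add y z
  right_distrib x y z := (mulMap (k := k) (R := R) (H := H)).map_add₂ x y z
  zero_mul x := (mulMap (k := k) (R := R) (H := H)).map_zero₂ x
  mul_zero x := (mulMap (k := k) (R := R) (H := H) x).map_zero
  neg_add_cancel := neg_add_cancel
  zsmul := (· • ·)
  zsmul_zero' := SubNegMonoid.zsmul_zero'
  zsmul_succ' := SubNegMonoid.zsmul_succ'
  zsmul_neg' := SubNegMonoid.zsmul_neg'
  nsmul := (· • ·)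
  nsmul_zero := AddMonoid.nsmul_zero
  nsmul_succ := AddMonoid.nsmul_succ

noncomputable instance : Algebra k (SmashProduct k R H) :=
  Algebra.ofModule
    (fun c x y => (mulMap (k := k) (R := R) (H := H)).map_smul₂ c x y)
    (fun c x y => (mulMap (k := k) (R := R) (H := H) x).map_smul c y)

/-- The multiplication rule `(r # h) (r' # h') = ∑ r (h₁ • r') # h₂ h'`. -/
theorem mk_mul_mk (r r' : R) (h h' : H) {ι : Type*} (ρ : Coalgebra.Repr k h ι) :
    (mk r h * mk r' h' : SmashProduct k R H) =
      ∑ i ∈ ρ.index, mk (r * (ρ.left i • r')) (ρ.right i * h') :=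
  mulMap_tmul_repr r r' h h' ρ

theorem one_def : (1 : SmashProduct k R H) = mk 1 1 := rfl

end SmashProduct

/-! ## The Grothendieck group of finitely generated modules -/

/-- The relations `[V] - [U] - [W]`, one for every short exact sequence `0 → U → V → W → 0` of
finitely generated left `A`-modules. -/
def G0Relations (A : Type uA) [Ring A] : Set (FreeAbelianGroup (FGModuleCat.{uA} A)) :=
  {x | ∃ (U V W : FGModuleCat.{uA} A) (f : U →ₗ[A] V) (g : V →ₗ[A] W),
    Function.Injective f ∧ Function.Exact f g ∧ Function.Surjective g ∧
    x = FreeAbelianGroup.of V - FreeAbelianGroup.of U - FreeAbelianGroup.of W}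

/-- `G₀(A)`: the Grothendieck group of the category of finitely generated left modules over the
(left noetherian) ring `A`. -/
abbrev G0 (A : Type uA) [Ring A] : Type (uA + 1) :=
  FreeAbelianGroup (FGModuleCat.{uA} A) ⧸ AddSubgroup.closure (G0Relations A)

/-- The class `[M]` in `G₀(A)` of a finitely generated left `A`-module `M`. -/
def G0.cls (A : Type uA) [Ring A] (M : Type uA) [AddCommGroup M] [Module A M]
    (_ : Module.Finite A M) : G0 A :=
  QuotientAddGroup.mk (FreeAbelianGroup.of (FGModuleCat.of A M))

/-! ## Dimensions of projective modules -/

/-- The greatest common divisor of the dimensions over `k` of all finitely generated projective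
left `H`-modules, where `H` is a nonzero finite-dimensional `k`-algebra. -/
noncomputable def projDimGCD (k : Type uk) (H : Type uH) [Field k] [Ring H] [Algebra k H] : ℕ :=
  sSup {d : ℕ | ∀ (P : Type uH) [AddCommGroup P] [Module k P] [Module H P] [IsScalarTower k H P]
    [Module.Finite H P] [Module.Projective H P], d ∣ Module.finrank k P}

/-! Write `δ` for `projDimGCD k H` and `T` for `R # H`. The theorem follows from a homomorphism `φ :
G₀(T) → ℤ/δ` with `φ [M] = dim M` whenever `M` is finite-dimensional: if `n` is the order of `[M]`,
then `δ ∣ n · dim M`, and dividing by `gcd(δ, dim M)` leaves two coprime factors.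

The homomorphism is a stable dimension. The restriction to `H` of a finitely generated `T`-module
`V` splits as `J ⊕ W` with `J` injective and `W` finite-dimensional, and `φ [V]` is `dim W` modulo
`δ`. Three facts are needed.

Existence (`exists_hasStableDim`). Let `J` be a maximal injective submodule and `W = V / J`, so that
`W` has no nonzero injective submodule. For a simple module `X = H / L`, an `H`-map `X → V`
multiplied by an element of `ΛR` factors through the coinduced module `Hom_k(H, X)`, up to
summation: this is an averaging with `∑ Λ₁ ⊗ S(Λ₂)`. That module is injective of finite length, so
the composite to `W` is zero. As `V` is noetherian over `R^H` and `ΛR` has finite codimension in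
`R^H`, every `Hom_H(X, W)` is finite-dimensional, and hence so is `W`.

Uniqueness (`HasStableDim.natCast_eq`). The integral makes injective modules projective, and a
Schanuel-type comparison of two splittings shows that the two dimensions differ by dimensions of
finitely generated projective modules.

Additivity (`HasStableDim.of_exact`). The injective part of the quotient, being projective, lifts to
the middle term. -/

namespace HopfAlgebra

variable {k H : Type*} [Field k] [Ring H] [HopfAlgebra k H]

/-! ### The Galois map and the Casimir element of an integral. -/

theorem sum_counit_right_smul {ι : Type*} {a : H} (ρ : Coalgebra.Repr k a ι) :
    ∑ i ∈ ρ.index, (Coalgebra.counit (ρ.right i) : k) • ρ.left i = a := by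
  have := congrArg (TensorProduct.rid k H) (Coalgebra.sum_tmul_counit_eq ρ)
  simpa only [map_sum, TensorProduct.rid_tmul, one_smul] using this

/-- The linear map `H ⊗ V → H ⊗ V`, `a ⊗ v ↦ ∑ a₁ ⊗ a₂ v`. -/
noncomputable def galoisMap (k H V : Type*) [Field k] [Ring H] [HopfAlgebra k H]
    [AddCommGroup V] [Module k V] [Module H V] [IsScalarTower k H V] :
    H ⊗[k] V →ₗ[k] H ⊗[k] V :=
  TensorProduct.lift <| LinearMap.mk₂ k
    (fun a v => TensorProduct.map LinearMap.id (actOn k H v) (Coalgebra.comul a))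
    (by intro a b v; simp)
    (by intro c a v; rw [map_smul, map_smul])
    (by
      intro a v w
      have : actOn k H (v + w) = actOn k H v + actOn k H w := by ext; simp
      rw [this, TensorProduct.map_add_right, LinearMap.add_apply])
    (by
      intro c a v
      have : actOn k H (c • v) = c • actOn k H v := by
        ext h; exact smul_comm h c v
      rw [this, TensorProduct.map_smul_right, LinearMap.smul_apply])

section

variable {V : Type*} [AddCommGroup V] [Module k V] [Module H V] [IsScalarTower k H V]

theorem galoisMap_tmul_repr {ι : Type*} {a : H} (ρ : Coalgebra.Repr k a ι) (v : V) :
    galoisMap k H V (a ⊗ₜ v) = ∑ i ∈ ρ.index, ρ.left i ⊗ₜ (ρ.right i • v) := by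
  simp [galoisMap, ← ρ.eq]

end

theorem galoisMap_mul (h : H) (x : H ⊗[k] H) :
    galoisMap k H H ((h ⊗ₜ 1) * x) = Coalgebra.comul h * galoisMap k H H x := by
  induction x with
  | zero => simp
  | add x y hx hy => simp only [mul_add, map_add, hx, hy]
  | tmul a b =>
    have e : ∀ c : H, TensorProduct.map LinearMap.id (actOn k H b) (Coalgebra.comul (R := k) c) =
        Coalgebra.comul c * ((1 : H) ⊗ₜ[k] b) := by
      intro c
      have σ := Coalgebra.Repr.arbitrary k c
      simp [← σ.eq, Finset.sum_mul]
    simp only [galoisMap, TensorProduct.lift.tmul, LinearMap.mk₂_apply, e,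
      Algebra.TensorProduct.tmul_mul_tmul, one_mul]
    rw [Bialgebra.comul_mul, mul_assoc]

theorem galoisMap_mul_right (h : H) (x : H ⊗[k] H) :
    galoisMap k H H (x * ((1 : H) ⊗ₜ h)) = galoisMap k H H x * ((1 : H) ⊗ₜ h) := by
  induction x with
  | zero => simp
  | add x y hx hy => simp only [add_mul, map_add, hx, hy]
  | tmul a b =>
    have ρ := Coalgebra.Repr.arbitrary k a
    simp [galoisMap_tmul_repr ρ, Finset.sum_mul, mul_assoc]

/-- The antipode gives the left inverse `a ⊗ b ↦ ∑ a₁ ⊗ S(a₂) b`. -/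
theorem galoisMap_injective : Function.Injective (galoisMap k H H) := by
  let γ : H ⊗[k] H →ₗ[k] H ⊗[k] H :=
    LinearMap.lTensor H (LinearMap.mul' k H) ∘ₗ
      (TensorProduct.assoc k H H H).toLinearMap ∘ₗ
      LinearMap.rTensor H (LinearMap.lTensor H (antipode k) ∘ₗ Coalgebra.comul)
  refine Function.LeftInverse.injective (g := γ) fun x => ?_
  induction x with
  | zero => simp
  | add x y hx hy => simp only [map_add, hx, hy]
  | tmul a b =>
    have ρ := Coalgebra.Repr.arbitrary k a
    let Φ : H ⊗[k] (H ⊗[k] H) →ₗ[k] H ⊗[k] H :=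
      LinearMap.lTensor H (LinearMap.mulRight k b ∘ₗ LinearMap.mul' k H ∘ₗ
        LinearMap.rTensor H (antipode k))
    have key := congrArg Φ (Coalgebra.sum_tmul_tmul_eq ρ
      (fun i => Coalgebra.Repr.arbitrary k (ρ.left i))
      (fun i => Coalgebra.Repr.arbitrary k (ρ.right i)))
    have hl : ∀ i, LinearMap.lTensor H (antipode k) (Coalgebra.comul (R := k) (ρ.left i)) =
        ∑ j ∈ (Coalgebra.Repr.arbitrary k (ρ.left i)).index,
          (Coalgebra.Repr.arbitrary k (ρ.left i)).left j ⊗ₜ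
            antipode k ((Coalgebra.Repr.arbitrary k (ρ.left i)).right j) := by
      intro i
      conv_lhs => rw [← (Coalgebra.Repr.arbitrary k (ρ.left i)).eq]
      simp
    simp only [Φ, map_sum, LinearMap.lTensor_tmul, LinearMap.comp_apply, LinearMap.rTensor_tmul,
      LinearMap.mul'_apply, LinearMap.mulRight_apply] at key
    simp only [galoisMap_tmul_repr ρ, γ, map_sum, LinearMap.comp_apply, LinearMap.rTensor_tmul, hl,
      TensorProduct.sum_tmul, LinearEquiv.coe_coe, TensorProduct.assoc_tmul,
      LinearMap.lTensor_tmul, LinearMap.mul'_apply, smul_eq_mul, ← mul_assoc]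
    rw [key]
    simp only [← TensorProduct.tmul_sum, ← Finset.sum_mul, sum_antipode_mul_eq_smul]
    simp only [smul_mul_assoc, one_mul, TensorProduct.tmul_smul, TensorProduct.smul_tmul',
      ← TensorProduct.sum_tmul, sum_counit_right_smul]

/-- The element `∑ Λ₁ ⊗ S(Λ₂)` of `H ⊗ H`. -/
noncomputable def casimir (k : Type*) {H : Type*} [Field k] [Ring H] [HopfAlgebra k H] (Λ : H) :
    H ⊗[k] H :=
  LinearMap.lTensor H (antipode k) (Coalgebra.comul Λ)

theorem casimir_repr {ι : Type*} {Λ : H} (ρ : Coalgebra.Repr k Λ ι) :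
    casimir k Λ = ∑ i ∈ ρ.index, ρ.left i ⊗ₜ antipode k (ρ.right i) := by
  simp [casimir, ← ρ.eq]

/-- In Sweedler notation the left side is `∑ f(Λ₁)(Λ₂ S(Λ₃) v)`, and the antipode axiom collapses
`Λ₂ S(Λ₃)` to a counit. A general `f` is allowed because `smulMap_casimir` needs one that involves
the action on `R`. -/
theorem lift_casimir {V W : Type*} [AddCommGroup V] [Module k V] [Module H V]
    [IsScalarTower k H V] [AddCommGroup W] [Module k W] (f : H →ₗ[k] V →ₗ[k] W) (Λ : H) (v : V) :
    TensorProduct.lift f (galoisMap k H V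
      (TensorProduct.map LinearMap.id (actOn k H v) (casimir k Λ))) = f Λ v := by
  have ρ := Coalgebra.Repr.arbitrary k Λ
  let Φ : H ⊗[k] (H ⊗[k] H) →ₗ[k] W :=
    TensorProduct.lift f ∘ₗ LinearMap.lTensor H (actOn k H v ∘ₗ LinearMap.mul' k H ∘ₗ
      LinearMap.lTensor H (antipode k))
  have key := congrArg Φ (Coalgebra.sum_tmul_tmul_eq ρ
    (fun i => Coalgebra.Repr.arbitrary k (ρ.left i))
    (fun i => Coalgebra.Repr.arbitrary k (ρ.right i)))
  simp only [Φ, map_sum, LinearMap.lTensor_tmul, LinearMap.comp_apply,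
      LinearMap.mul'_apply, TensorProduct.lift.tmul] at key
  simp only [casimir_repr ρ, map_sum, TensorProduct.map_tmul,
    galoisMap_tmul_repr (Coalgebra.Repr.arbitrary k (ρ.left _)), TensorProduct.lift.tmul,
    LinearMap.id_apply, actOn_apply, ← mul_smul] at key ⊢
  rw [key]
  have h1 : ∀ i, ∑ x ∈ (Coalgebra.Repr.arbitrary k (ρ.right i)).index, f (ρ.left i)
      (((Coalgebra.Repr.arbitrary k (ρ.right i)).left x *
        antipode k ((Coalgebra.Repr.arbitrary k (ρ.right i)).right x)) • v) =
      f ((Coalgebra.counit (ρ.right i) : k) • ρ.left i) v := by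
    intro i
    rw [← map_sum, ← Finset.sum_smul, sum_mul_antipode_eq_smul]
    simp
  simp only [h1]
  rw [← LinearMap.sum_apply, ← map_sum]
  congr 2
  exact sum_counit_right_smul ρ

theorem galoisMap_casimir (Λ : H) (V : Type*) [AddCommGroup V] [Module k V] [Module H V]
    [IsScalarTower k H V] (v : V) :
    galoisMap k H V (TensorProduct.map LinearMap.id (actOn k H v) (casimir k Λ)) = Λ ⊗ₜ v := by
  simpa only [TensorProduct.lift_mk, LinearMap.id_apply, TensorProduct.mk_apply] using
    lift_casimir (TensorProduct.mk k H V) Λ v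

/-- The Galois map sends `casimir k Λ` to `Λ ⊗ 1`. It therefore sends the two sides to `Δ(h)(Λ ⊗ 1)`
and `Λ ⊗ h`, which agree because `Λ` is a left integral; injectivity finishes. This centrality is
what makes every averaging map below `H`-linear. -/
theorem mul_casimir {Λ : H} (hΛ : IsLeftIntegral k Λ) (h : H) :
    (h ⊗ₜ 1) * casimir k Λ = casimir k Λ * ((1 : H) ⊗ₜ h) := by
  have e : galoisMap k H H (casimir k Λ) = Λ ⊗ₜ 1 := by
    rw [← galoisMap_casimir Λ H (1 : H)]
    congr 1
    have : actOn k H (1 : H) = LinearMap.id := by ext; simp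
    rw [this, TensorProduct.map_id, LinearMap.id_apply]
  apply galoisMap_injective (k := k)
  rw [galoisMap_mul, galoisMap_mul_right, e]
  have ρ := Coalgebra.Repr.arbitrary k h
  rw [← ρ.eq]
  simp only [Finset.sum_mul, Algebra.TensorProduct.tmul_mul_tmul, hΛ _, mul_one, one_mul,
    TensorProduct.smul_tmul, ← TensorProduct.tmul_sum, Coalgebra.sum_counit_smul]

end HopfAlgebra

/-! ### Injective modules, in the form of Baer's criterion, are projective. -/

namespace Module.Baer

section

variable {A : Type*} [Ring A]

theorem exists_retraction {M N : Type*} [AddCommGroup M] [Module A M] [AddCommGroup N]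
    [Module A N] (hM : Module.Baer A M) (f : M →ₗ[A] N) (hf : Function.Injective f) :
    ∃ r : N →ₗ[A] M, r ∘ₗ f = LinearMap.id :=
  hM.extension_property f hf LinearMap.id

theorem prod {M N : Type*} [AddCommGroup M] [Module A M] [AddCommGroup N] [Module A N]
    (hM : Module.Baer A M) (hN : Module.Baer A N) : Module.Baer A (M × N) := by
  intro I g
  obtain ⟨a, ha⟩ := hM I (LinearMap.fst A M N ∘ₗ g)
  obtain ⟨b, hb⟩ := hN I (LinearMap.snd A M N ∘ₗ g)
  exact ⟨a.prod b, fun x hx => by simp [ha x hx, hb x hx]⟩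

theorem of_subsingleton (M : Type*) [AddCommGroup M] [Module A M] [Subsingleton M] :
    Module.Baer A M :=
  fun _ _ => ⟨0, fun _ _ => Subsingleton.elim _ _⟩

theorem of_retract {M N : Type*} [AddCommGroup M] [Module A M] [AddCommGroup N] [Module A N]
    (hM : Module.Baer A M) (i : N →ₗ[A] M) (r : M →ₗ[A] N) (h : r ∘ₗ i = LinearMap.id) :
    Module.Baer A N := by
  intro I g
  obtain ⟨a, ha⟩ := hM I (i ∘ₗ g)
  exact ⟨r ∘ₗ a, fun x hx => by simpa [ha x hx] using LinearMap.congr_fun h _⟩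

end

section

variable {k H : Type*} [Field k] [Ring H] [HopfAlgebra k H]

/-- A nonzero left integral embeds every module into a free module, so that injective modules are
projective. -/
theorem projective {Λ : H} (hΛ₀ : Λ ≠ 0) (hΛ : IsLeftIntegral k Λ) {V : Type*} [AddCommGroup V]
    [Module k V] [Module H V] [IsScalarTower k H V] (hV : Module.Baer H V) :
    Module.Projective H V := by
  let θ : V →ₗ[H] H ⊗[k] V :=
    { toFun := fun v => TensorProduct.map LinearMap.id (actOn k H v) (HopfAlgebra.casimir k Λ)
      map_add' := fun v w => by
        have : actOn k H (v + w) = actOn k H v + actOn k H w := by ext; simp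
        rw [this, TensorProduct.map_add_right, LinearMap.add_apply]
      map_smul' := fun h v => by
        have key : ∀ x : H ⊗[k] H, TensorProduct.map LinearMap.id (actOn k H (h • v)) x =
            TensorProduct.map LinearMap.id (actOn k H v) (x * ((1 : H) ⊗ₜ h)) := by
          intro x
          induction x with
          | zero => simp
          | add x y hx hy => simp only [map_add, add_mul, hx, hy]
          | tmul a b => simp [mul_smul]
        have key' : ∀ x : H ⊗[k] H, TensorProduct.map LinearMap.id (actOn k H v) ((h ⊗ₜ 1) * x) =
            h • TensorProduct.map LinearMap.id (actOn k H v) x := by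
          intro x
          induction x with
          | zero => simp
          | add x y hx hy => simp only [map_add, mul_add, smul_add, hx, hy]
          | tmul a b => simp [TensorProduct.smul_tmul']
        rw [key, ← HopfAlgebra.mul_casimir hΛ, key', RingHom.id_apply] }
  -- The Galois map takes `θ v` to `Λ ⊗ v`, which vanishes only for `v = 0` since `Λ ≠ 0` and `V` is
  -- flat over `k`.
  have hθ : Function.Injective θ := by
    rw [injective_iff_map_eq_zero]
    intro v hv
    have := HopfAlgebra.galoisMap_casimir (k := k) Λ V v
    change HopfAlgebra.galoisMap k H V (θ v) = _ at this
    rw [hv, map_zero] at this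
    by_contra hv0
    have hinj : Function.Injective (LinearMap.rTensor V (LinearMap.toSpanSingleton k H Λ)) :=
      Module.Flat.rTensor_preserves_injective_linearMap _
        (LinearMap.ker_eq_bot.1 (LinearMap.ker_toSpanSingleton k hΛ₀))
    have h1 : LinearMap.rTensor V (LinearMap.toSpanSingleton k H Λ) ((1 : k) ⊗ₜ v) = 0 := by
      simp [← this]
    have h2 := hinj (h1.trans (map_zero _).symm)
    exact hv0 (by simpa using congrArg (TensorProduct.lid k V) h2)
  -- With `H` acting on the left factor only, `H ⊗ V` is free, and the injective module `V` is a
  -- direct summand of it.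
  obtain ⟨r, hr⟩ := hV.exists_retraction θ hθ
  exact Module.Projective.of_split θ r hr

end

end Module.Baer

/-! ### Coinduced modules. -/

/-- The module `Hom_k(H, X)` with `(h • φ) a = φ (a h)`. -/
def Coinduced (k H X : Type*) [Field k] [Ring H] [Algebra k H] [AddCommGroup X] [Module k X] :
    Type _ :=
  H →ₗ[k] X

namespace Coinduced

variable {k H X : Type*} [Field k] [Ring H] [Algebra k H] [AddCommGroup X] [Module k X]

noncomputable instance : AddCommGroup (Coinduced k H X) :=
  inferInstanceAs (AddCommGroup (H →ₗ[k] X))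

noncomputable instance : Module k (Coinduced k H X) :=
  inferInstanceAs (Module k (H →ₗ[k] X))

/-- Evaluation of an element of `Hom_k(H, X)`. -/
noncomputable def eval : Coinduced k H X →ₗ[k] H →ₗ[k] X := LinearMap.id

theorem ext {φ ψ : Coinduced k H X} (h : ∀ a, eval φ a = eval ψ a) : φ = ψ :=
  LinearMap.ext h

noncomputable instance : Module H (Coinduced k H X) where
  smul h φ := (eval φ ∘ₗ LinearMap.mulRight k h : H →ₗ[k] X)
  one_smul φ := ext fun a => congrArg (eval φ) (mul_one a)
  mul_smul g h φ := ext fun a => congrArg (eval φ) (mul_assoc a g h).symm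
  smul_zero _ := rfl
  smul_add _ _ _ := rfl
  add_smul g h φ := ext fun a => (congrArg (eval φ) (mul_add a g h)).trans (map_add _ _ _)
  zero_smul φ := ext fun a => (congrArg (eval φ) (mul_zero a)).trans (map_zero _)

theorem eval_smul (h a : H) (φ : Coinduced k H X) : eval (h • φ) a = eval φ (a * h) := rfl

instance : IsScalarTower k H (Coinduced k H X) where
  smul_assoc c h φ := ext fun a => by
    rw [eval_smul, mul_smul_comm, map_smul, map_smul, LinearMap.smul_apply, eval_smul]

instance [FiniteDimensional k H] [FiniteDimensional k X] :
    FiniteDimensional k (Coinduced k H X) :=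
  inferInstanceAs (FiniteDimensional k (H →ₗ[k] X))

/-- By adjunction an `H`-map into `Hom_k(H, X)` is the same as a `k`-linear map into `X`, namely its
evaluation at `1`, and linear maps extend from subspaces. -/
theorem baer : Module.Baer H (Coinduced k H X) := by
  intro I g
  let e : (I.restrictScalars k) →ₗ[k] X :=
    { toFun := fun a => eval (g a) 1
      map_add' := fun a b => by
        have : g (a + b : I) = g a + g b := map_add g a b
        rw [← LinearMap.add_apply, ← map_add, ← this]
      map_smul' := fun c a => by
        have : g (c • a : I) = c • g a := LinearMap.map_smul_of_tower g c a
        rw [RingHom.id_apply, ← LinearMap.smul_apply, ← map_smul, ← this] }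
  obtain ⟨f, hf⟩ := e.exists_extend
  refine ⟨LinearMap.toSpanSingleton H (Coinduced k H X) f, fun x hx => ext fun a => ?_⟩
  have h1 : f (a * x) = e ⟨a * x, I.mul_mem_left a hx⟩ :=
    LinearMap.congr_fun hf ⟨a * x, I.mul_mem_left a hx⟩
  have h2 : g ⟨a * x, I.mul_mem_left a hx⟩ = a • g ⟨x, hx⟩ := by
    rw [← map_smul]; rfl
  change f (a * x) = _
  rw [h1]
  change eval (g ⟨a * x, I.mul_mem_left a hx⟩) 1 = _
  rw [h2, eval_smul, one_mul]

/-- The embedding of an `H`-module into its coinduced module. -/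
noncomputable def coev (k : Type*) {H X : Type*} [Field k] [Ring H] [Algebra k H] [AddCommGroup X]
    [Module k X] [Module H X] [IsScalarTower k H X] : X →ₗ[H] Coinduced k H X where
  toFun x := actOn k H x
  map_add' x y := ext fun a => smul_add a x y
  map_smul' h x := ext fun a => (mul_smul a h x).symm

end Coinduced

/-! ### Injective submodules. -/

/-- A map out of a finite length injective module that is injective on a nonzero submodule has a
nonzero injective submodule in its range. -/
theorem exists_baer_le_range {A E V X : Type*} [Ring A] [AddCommGroup E] [Module A E]
    [AddCommGroup V] [Module A V] [AddCommGroup X] [Module A X] [IsNoetherian A E]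
    [IsArtinian A E] (hE : Module.Baer A E) [Nontrivial X] (i : X →ₗ[A] E) (p : E →ₗ[A] V)
    (hpi : Function.Injective (p ∘ₗ i)) :
    ∃ N : Submodule A V, N ≠ ⊥ ∧ Module.Baer A N := by
  let j : X × LinearMap.ker p →ₗ[A] E := i.coprod (LinearMap.ker p).subtype
  have hj : Function.Injective j := by
    rw [injective_iff_map_eq_zero]
    rintro ⟨x, y, hy⟩ h
    have h' : i x + y = 0 := by simpa [j] using h
    have hx : (p ∘ₗ i) x = 0 := by
      have := congrArg p h'
      rw [map_add, LinearMap.mem_ker.1 hy, add_zero, map_zero] at this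
      exact this
    have hx0 : x = 0 := hpi (hx.trans (map_zero _).symm)
    subst hx0
    have : y = 0 := by simpa using h'
    subst this
    rfl
  -- `i(X)` and `ker p` are independent, so injectivity of `E` gives an endomorphism `θ` that is the
  -- identity on `i(X)` and zero on `ker p`.
  obtain ⟨θ, hθ⟩ := hE.extension_property j hj (i ∘ₗ LinearMap.fst A _ _)
  have hθi : ∀ x, θ (i x) = i x := fun x => by
    simpa [j] using LinearMap.congr_fun hθ (x, 0)
  have hθk : ∀ y, p y = 0 → θ y = 0 := fun y hy => by
    simpa [j] using LinearMap.congr_fun hθ (0, ⟨y, hy⟩)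
  -- Fitting's lemma makes the range of `θ ^ n` a direct summand of `E`, hence injective. It
  -- contains `i(X)`, and for `n ≥ 1` it meets `ker p` trivially because `θ ^ n` kills `ker p`.
  obtain ⟨n, hn, hn1⟩ := (θ.eventually_isCompl_ker_pow_range_pow.and
    (Filter.eventually_ge_atTop 1)).exists
  have hb : Module.Baer A (LinearMap.range (θ ^ n)) := by
    exact hE.of_retract _ _ (Submodule.projectionOnto_comp_subtype hn.symm)
  let q : LinearMap.range (θ ^ n) →ₗ[A] V := p ∘ₗ (LinearMap.range (θ ^ n)).subtype
  have hq : Function.Injective q := by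
    rw [injective_iff_map_eq_zero]
    rintro ⟨y, hy⟩ h
    have hk : y ∈ LinearMap.ker (θ ^ n) := by
      obtain ⟨m, rfl⟩ := Nat.exists_eq_add_of_le' hn1
      rw [LinearMap.mem_ker, pow_succ, Module.End.mul_apply, hθk y h, map_zero]
    exact Subtype.ext (Submodule.disjoint_def.1 hn.disjoint y hk hy)
  refine ⟨LinearMap.range q, ?_, hb.of_equiv (LinearEquiv.ofInjective q hq)⟩
  obtain ⟨x, hx⟩ := exists_ne (0 : X)
  intro h0
  have hir : i x ∈ LinearMap.range (θ ^ n) := by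
    refine ⟨i x, ?_⟩
    clear hn hn1 hb hq h0 q
    induction n with
    | zero => rfl
    | succ n ih => rw [pow_succ, Module.End.mul_apply, hθi, ih]
  have : q ⟨i x, hir⟩ = 0 := by
    have : q ⟨i x, hir⟩ ∈ LinearMap.range q := ⟨_, rfl⟩
    rwa [h0, Submodule.mem_bot] at this
  exact hx (hpi (this.trans (map_zero _).symm))

/-- Zorn's lemma applies because `A` is noetherian: a map from a left ideal to the union of a chain
has finitely generated image, so it lands in one member of the chain and extends there. -/
theorem exists_maximal_baer (A V : Type*) [Ring A] [IsNoetherianRing A] [AddCommGroup V]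
    [Module A V] : ∃ J : Submodule A V, Maximal (fun J : Submodule A V => Module.Baer A J) J := by
  obtain ⟨J, -, hJ⟩ := zorn_le_nonempty₀ {J : Submodule A V | Module.Baer A J} (by
    intro c hc hchain K hK
    refine ⟨sSup c, ?_, fun z hz => le_sSup hz⟩
    intro I g
    have hfg : (LinearMap.range ((sSup c).subtype ∘ₗ g)).FG := by
      rw [LinearMap.range_eq_map]
      exact (IsNoetherian.noetherian (⊤ : Submodule A I)).map _
    have hle : LinearMap.range ((sSup c).subtype ∘ₗ g) ≤ sSup c := by
      rintro _ ⟨x, rfl⟩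
      exact (g x).2
    obtain ⟨J, hJ, hle⟩ :=
      ((CompleteLattice.isCompactElement_iff_le_of_directed_sSup_le _ _).1
        ((Submodule.fg_iff_compact _).1 hfg)) c ⟨K, hK⟩ hchain.directedOn hle
    obtain ⟨f, hf⟩ := hc hJ I (((sSup c).subtype ∘ₗ g).codRestrict J fun x => hle ⟨x, rfl⟩)
    refine ⟨Submodule.inclusion (le_sSup hJ) ∘ₗ f, fun x hx => Subtype.ext ?_⟩
    simp [hf x hx]) ⊥ (Module.Baer.of_subsingleton _)
  exact ⟨J, hJ⟩

/-! ### Dimensions modulo `δ`. -/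

/-- The supremum defining `projDimGCD` is attained, since the common divisors are bounded by `dim H
> 0`. A module in another universe is replaced by an isomorphic quotient of some `Hⁿ`. -/
theorem projDimGCD_dvd_finrank (k : Type uk) (H : Type uH) [Field k] [Ring H] [Algebra k H]
    [FiniteDimensional k H] [Nontrivial H] (Q : Type*) [AddCommGroup Q] [Module k Q] [Module H Q]
    [IsScalarTower k H Q] [Module.Finite H Q] [Module.Projective H Q] :
    projDimGCD k H ∣ Module.finrank k Q := by
  have hmem : projDimGCD k H ∈ {d : ℕ | ∀ (P : Type uH) [AddCommGroup P] [Module k P] [Module H P]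
      [IsScalarTower k H P] [Module.Finite H P] [Module.Projective H P],
      d ∣ Module.finrank k P} := by
    refine Nat.sSup_mem ⟨1, fun P _ _ _ _ _ _ => one_dvd _⟩ ⟨Module.finrank k H, fun d hd => ?_⟩
    exact Nat.le_of_dvd Module.finrank_pos (hd H)
  obtain ⟨n, f, hf⟩ := Module.Finite.exists_fin' H Q
  let e : ((Fin n → H) ⧸ LinearMap.ker f) ≃ₗ[H] Q := f.quotKerEquivOfSurjective hf
  have : Module.Projective H ((Fin n → H) ⧸ LinearMap.ker f) := Module.Projective.of_equiv e.symm
  rw [← (e.restrictScalars k).finrank_eq]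
  exact hmem _

/-- The retract `S` cuts the possibly infinite `L` down to finite size without losing the image of
`F'`. The map `α : F × S → P` has kernel isomorphic to `F'`, and its range `Q` is a direct summand
of `P`. So `dim F + dim S = dim F' + dim Q` with `S` and `Q` finitely generated projective. -/
theorem finrank_modEq_of_equiv_of_retract (k : Type*) (H : Type*) [Field k] [Ring H] [Algebra k H]
    [FiniteDimensional k H] [Nontrivial H] {F F' P L S : Type*}
    [AddCommGroup F] [Module k F] [Module H F] [IsScalarTower k H F] [FiniteDimensional k F]
    [AddCommGroup F'] [Module k F'] [Module H F'] [IsScalarTower k H F'] [FiniteDimensional k F']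
    [AddCommGroup P] [Module k P] [Module H P] [IsScalarTower k H P] [Module.Projective H P]
    [AddCommGroup L] [Module H L]
    [AddCommGroup S] [Module k S] [Module H S] [IsScalarTower k H S] [FiniteDimensional k S]
    [Module.Projective H S] (e : (F × L) ≃ₗ[H] (F' × P)) (i₀ : S →ₗ[H] L) (r : L →ₗ[H] S)
    (hr : ∀ x, r (i₀ x) = x) (hs : ∀ x : F', i₀ (r (e.symm (x, 0)).2) = (e.symm (x, 0)).2) :
    (Module.finrank k F : ZMod (projDimGCD k H)) = Module.finrank k F' := by
  let i : F × S →ₗ[H] F × L := LinearMap.prodMap LinearMap.id i₀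
  let ρ : F × L →ₗ[H] F × S := LinearMap.prodMap LinearMap.id r
  let α : F × S →ₗ[H] P := LinearMap.snd H _ _ ∘ₗ e.toLinearMap ∘ₗ i
  have hi : Function.Injective i := by
    rintro ⟨a, b⟩ ⟨c, d⟩ h
    have h1 : a = c := congrArg Prod.fst h
    have h2 : i₀ b = i₀ d := congrArg Prod.snd h
    rw [h1, ← hr b, h2, hr]
  have hρ : ∀ x : F', i (ρ (e.symm (x, 0))) = e.symm (x, 0) := fun x => by
    exact Prod.ext rfl (hs x)
  let Q := LinearMap.range α
  have hQproj : Module.Projective H Q := by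
    refine Module.Projective.of_split (M := P) Q.subtype
      (α.rangeRestrict ∘ₗ ρ ∘ₗ e.symm.toLinearMap ∘ₗ LinearMap.inr H F' P) ?_
    ext ⟨_, g, rfl⟩
    change α (ρ (e.symm (0, α g))) = α g
    -- The correction term comes from `F'`, and `α ∘ ρ ∘ e.symm` kills `F'`; hence the composite
    -- returns `α g`.
    have h1 : ((0 : F'), α g) = e (i g) - ((e (i g)).1, 0) := by
      refine Prod.ext ?_ ?_
      · simp
      · simp [α]
    rw [h1, map_sub, e.symm_apply_apply, map_sub, map_sub]
    have h2 : ρ (i g) = g := Prod.ext rfl (hr g.2)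
    have h3 : α (ρ (e.symm ((e (i g)).1, 0))) = 0 := by
      change (e (i (ρ (e.symm ((e (i g)).1, 0))))).2 = 0
      rw [hρ, e.apply_symm_apply]
    rw [h2, h3, sub_zero]
  let β : F' →ₗ[H] F × S := ρ ∘ₗ e.symm.toLinearMap ∘ₗ LinearMap.inl H F' P
  have hβi : ∀ x, e (i (β x)) = (x, 0) := fun x => by
    change e (i (ρ (e.symm (x, 0)))) = (x, 0)
    rw [hρ, e.apply_symm_apply]
  have hβ : Function.Injective β := fun x y h => by
    have := (hβi x).symm.trans ((congrArg (fun z => e (i z)) h).trans (hβi y))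
    simpa using this
  have hker : LinearMap.ker α = LinearMap.range β := by
    ext g
    constructor
    · intro hg
      refine ⟨(e (i g)).1, hi (e.injective ?_)⟩
      rw [hβi]
      exact Prod.ext rfl (LinearMap.mem_ker.1 hg).symm
    · rintro ⟨x, rfl⟩
      change (e (i (β x))).2 = 0
      rw [hβi]
  have hdim := LinearMap.finrank_range_add_finrank_ker (K := k) (V := F × S) (V₂ := P)
    (α.restrictScalars k)
  have h1 : Module.finrank k (LinearMap.ker (α.restrictScalars k)) = Module.finrank k F' := by
    have : LinearMap.ker (α.restrictScalars k) = LinearMap.range (β.restrictScalars k) := by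
      ext g
      exact SetLike.ext_iff.1 hker g
    rw [this]
    exact LinearMap.finrank_range_of_inj (f := β.restrictScalars k) hβ
  have hQfin' : FiniteDimensional k Q :=
    inferInstanceAs (FiniteDimensional k (LinearMap.range (α.restrictScalars k)))
  have hQfin : Module.Finite H Q := Module.Finite.of_restrictScalars_finite k H Q
  have hSfin : Module.Finite H S := Module.Finite.of_restrictScalars_finite k H S
  have h2 : projDimGCD k H ∣ Module.finrank k (LinearMap.range (α.restrictScalars k)) :=
    projDimGCD_dvd_finrank k H Q
  have h3 : projDimGCD k H ∣ Module.finrank k S := projDimGCD_dvd_finrank k H S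
  rw [h1, Module.finrank_prod] at hdim
  have h4 := congrArg (Nat.cast (R := ZMod (projDimGCD k H))) hdim
  rw [Nat.cast_add, Nat.cast_add, (ZMod.natCast_eq_zero_iff _ _).2 h2,
    (ZMod.natCast_eq_zero_iff _ _).2 h3, zero_add, add_zero] at h4
  exact h4.symm

theorem finrank_modEq_of_equiv (k : Type*) (H : Type*) [Field k] [Ring H] [Algebra k H]
    [FiniteDimensional k H] [Nontrivial H] {ι F F' P : Type*}
    [AddCommGroup F] [Module k F] [Module H F] [IsScalarTower k H F] [FiniteDimensional k F]
    [AddCommGroup F'] [Module k F'] [Module H F'] [IsScalarTower k H F'] [FiniteDimensional k F']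
    [AddCommGroup P] [Module k P] [Module H P] [IsScalarTower k H P] [Module.Projective H P]
    (e : (F × (ι →₀ H)) ≃ₗ[H] (F' × P)) :
    (Module.finrank k F : ZMod (projDimGCD k H)) = Module.finrank k F' := by
  classical
  -- `F'` is finitely generated, so its image involves only finitely many coordinates of the free
  -- module; these span the finite free retract `S`.
  obtain ⟨s, hs⟩ : ∃ s : Finset ι, ∀ x : F', (e.symm (x, 0)).2 ∈ Finsupp.supported H H (s : Set ι) := by
    have hfin : Module.Finite H F' := Module.Finite.of_restrictScalars_finite k H F'
    obtain ⟨t, ht⟩ := hfin.fg_top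
    let u : F' →ₗ[H] (ι →₀ H) := LinearMap.snd H _ _ ∘ₗ e.symm.toLinearMap ∘ₗ LinearMap.inl H _ _
    refine ⟨t.biUnion fun x => (u x).support, fun x => ?_⟩
    have hle : (⊤ : Submodule H F') ≤ (Finsupp.supported H H
        ((t.biUnion fun x => (u x).support : Finset ι) : Set ι)).comap u := by
      rw [← ht, Submodule.span_le]
      intro y hy
      change u y ∈ Finsupp.supported H H _
      rw [Finsupp.mem_supported]
      exact_mod_cast Finset.subset_biUnion_of_mem (fun x => (u x).support) hy
    exact hle (Submodule.mem_top (x := x))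
  let S : Submodule H (ι →₀ H) := Finsupp.supported H H (s : Set ι)
  let eS : S ≃ₗ[H] ((s : Set ι) →₀ H) := Finsupp.supportedEquivFinsupp (s : Set ι)
  have hSfin : Module.Finite H S := Module.Finite.equiv eS.symm
  have hSfin' : FiniteDimensional k S := Module.Finite.trans H S
  have hSproj : Module.Projective H S := Module.Projective.of_equiv eS.symm
  let r : (ι →₀ H) →ₗ[H] S := Finsupp.restrictDom H H (s : Set ι)
  refine finrank_modEq_of_equiv_of_retract k H e S.subtype r
    (fun x => LinearMap.congr_fun (Finsupp.restrictDom_comp_subtype (R := H) (M := H)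
      (s : Set ι)) x) fun x => ?_
  exact congrArg Subtype.val (LinearMap.congr_fun (Finsupp.restrictDom_comp_subtype (R := H)
    (M := H) (s : Set ι)) ⟨_, hs x⟩)

/-! ### The stable dimension of an `H`-module. -/

/-- `V` is the direct sum of an injective `H`-module and an `H`-module of dimension `d`. -/
def HasStableDim (k H V : Type*) [Field k] [Ring H] [Algebra k H] [AddCommGroup V] [Module k V]
    [Module H V] [IsScalarTower k H V] (d : ℕ) : Prop :=
  ∃ J : Submodule H V, Module.Baer H J ∧ FiniteDimensional k (V ⧸ J) ∧
    Module.finrank k (V ⧸ J) = d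

theorem Module.Baer.exists_equiv_prod {A V : Type*} [Ring A] [AddCommGroup V] [Module A V]
    {J : Submodule A V} (hJ : Module.Baer A J) :
    ∃ e : V ≃ₗ[A] (V ⧸ J) × J, ∀ v, (e v).1 = J.mkQ v := by
  obtain ⟨r, hr⟩ := hJ.exists_retraction J.subtype J.subtype_injective
  have hr' : ∀ x : J, r x = x := fun x => LinearMap.congr_fun hr x
  refine ⟨LinearEquiv.ofBijective (J.mkQ.prod r) ⟨?_, ?_⟩, fun v => rfl⟩
  · rw [injective_iff_map_eq_zero]
    intro v hv
    have h1 : J.mkQ v = 0 := congrArg Prod.fst hv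
    have h2 : r v = 0 := congrArg Prod.snd hv
    have h3 : v ∈ J := by simpa using h1
    have := (hr' ⟨v, h3⟩).symm.trans h2
    exact congrArg Subtype.val this
  · rintro ⟨q, j⟩
    obtain ⟨v, rfl⟩ := J.mkQ_surjective q
    refine ⟨v - r v + j, Prod.ext ?_ ?_⟩
    · change J.mkQ (v - r v + j) = J.mkQ v
      rw [map_add, map_sub]
      have : ∀ x : J, J.mkQ (x : V) = 0 := fun x => by simp
      rw [this, this, sub_zero, add_zero]
    · change r (v - r v + j) = j
      rw [map_add, map_sub, hr', hr', sub_self, zero_add]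

namespace HasStableDim

section

variable {k H : Type*} [Field k] [Ring H] [HopfAlgebra k H]

/-- With `J ⊕ C` free, `(V / J) ⊕ (J ⊕ C) ≅ V ⊕ C ≅ (V / J') ⊕ (J' ⊕ C)`, which is the situation of
`finrank_modEq_of_equiv`. -/
theorem natCast_eq [FiniteDimensional k H] {Λ : H} (hΛ₀ : Λ ≠ 0) (hΛ : IsLeftIntegral k Λ)
    {V : Type*} [AddCommGroup V] [Module k V] [Module H V] [IsScalarTower k H V] {d d' : ℕ}
    (h : HasStableDim k H V d) (h' : HasStableDim k H V d') :
    (d : ZMod (projDimGCD k H)) = d' := by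
  have : Nontrivial H := ⟨Λ, 0, hΛ₀⟩
  obtain ⟨J, hJ, hf, rfl⟩ := h
  obtain ⟨J', hJ', hf', rfl⟩ := h'
  have hP : Module.Projective H J := hJ.projective hΛ₀ hΛ
  have hP' : Module.Projective H J' := hJ'.projective hΛ₀ hΛ
  obtain ⟨e, -⟩ := hJ.exists_equiv_prod
  obtain ⟨e', -⟩ := hJ'.exists_equiv_prod
  obtain ⟨s, hs⟩ := Module.projective_def'.1 hP
  let p : (J →₀ H) →ₗ[H] J := Finsupp.linearCombination H id
  let C := LinearMap.ker p
  have hinl : Function.Injective s := fun x y hxy => by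
    simpa using (LinearMap.congr_fun hs x).symm.trans
      ((congrArg p hxy).trans (LinearMap.congr_fun hs y))
  let c : (J →₀ H) →ₗ[H] C := (LinearMap.id - s ∘ₗ p).codRestrict C fun x => by
    have := LinearMap.congr_fun hs (p x)
    simp only [LinearMap.comp_apply, LinearMap.id_apply] at this
    simp only [C, LinearMap.mem_ker, LinearMap.sub_apply, LinearMap.comp_apply, LinearMap.id_apply,
      map_sub]
    exact sub_eq_zero.2 this.symm
  have hps : ∀ x, p (s x) = x := fun x => LinearMap.congr_fun hs x
  have hcC : ∀ x : C, c x = x := fun x => Subtype.ext (by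
    change (x : J →₀ H) - s (p x) = x
    rw [LinearMap.mem_ker.1 x.2, map_zero, sub_zero])
  have hcs : ∀ x, c (s x) = 0 := fun x => Subtype.ext (by
    change s x - s (p (s x)) = 0
    rw [hps, sub_self])
  let f : (J →₀ H) ≃ₗ[H] J × C := LinearEquiv.ofLinearMap (p.prod c) (s.coprod C.subtype)
    (by
      ext x
      · simp [hps]
      · simp [hcs]
      · simp [LinearMap.mem_ker.1 x.2]
      · simp [hcC])
    (by
      refine LinearMap.ext fun x => ?_
      change s (p x) + (x - s (p x)) = x
      abel)
  have hC : Module.Projective H C :=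
    Module.Projective.of_split C.subtype c (LinearMap.ext hcC)
  exact finrank_modEq_of_equiv k H (P := J' × C)
    ((LinearEquiv.prodCongr (LinearEquiv.refl H (V ⧸ J)) f).trans
      ((LinearEquiv.prodAssoc H (V ⧸ J) J C).symm.trans
        ((LinearEquiv.prodCongr (e.symm.trans e') (LinearEquiv.refl H C)).trans
          (LinearEquiv.prodAssoc H (V ⧸ J') J' C))))

/-- The injective submodule `L` of `W` is projective, so it lifts along `g`; together with `f(J)` it
spans an injective submodule `K ≅ J × L` of `V`. The quotients by `J`, `K` and `L` again form a
short exact sequence. -/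
theorem of_exact {Λ : H} (hΛ₀ : Λ ≠ 0) (hΛ : IsLeftIntegral k Λ) {U V W : Type*}
    [AddCommGroup U] [Module k U] [Module H U] [IsScalarTower k H U]
    [AddCommGroup V] [Module k V] [Module H V] [IsScalarTower k H V]
    [AddCommGroup W] [Module k W] [Module H W] [IsScalarTower k H W]
    (f : U →ₗ[H] V) (g : V →ₗ[H] W) (hf : Function.Injective f) (hfg : Function.Exact f g)
    (hg : Function.Surjective g) {a b : ℕ} (hU : HasStableDim k H U a)
    (hW : HasStableDim k H W b) : HasStableDim k H V (a + b) := by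
  obtain ⟨J, hJ, hJf, rfl⟩ := hU
  obtain ⟨L, hL, hLf, rfl⟩ := hW
  have hP : Module.Projective H L := hL.projective hΛ₀ hΛ
  obtain ⟨σ, hσ⟩ := Module.projective_lifting_property g L.subtype hg
  have hσ' : ∀ x, g (σ x) = x := fun x => LinearMap.congr_fun hσ x
  have hgf : ∀ x, g (f x) = 0 := fun x => hfg.apply_apply_eq_zero x
  let j : J × L →ₗ[H] V := (f ∘ₗ J.subtype).coprod σ
  have hj : Function.Injective j := by
    rw [injective_iff_map_eq_zero]
    rintro ⟨x, y⟩ h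
    have h' : f x + σ y = 0 := h
    have hy : (y : W) = 0 := by
      have := congrArg g h'
      rwa [map_add, hgf, hσ', zero_add, map_zero] at this
    have hy0 : y = 0 := Subtype.ext hy
    subst hy0
    rw [map_zero, add_zero] at h'
    have hx0 : x = 0 := Subtype.ext (hf (h'.trans (map_zero f).symm))
    subst hx0
    rfl
  let K := LinearMap.range j
  have hJK : J ≤ K.comap f := fun x hx => ⟨(⟨x, hx⟩, 0), by simp [j]⟩
  have hKL : K ≤ L.comap g := by
    rintro _ ⟨⟨x, y⟩, rfl⟩
    change g (f x + σ y) ∈ L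
    rw [map_add, hgf, hσ', zero_add]
    exact y.2
  let φ : (U ⧸ J) →ₗ[H] (V ⧸ K) := J.mapQ K f hJK
  let ψ : (V ⧸ K) →ₗ[H] (W ⧸ L) := K.mapQ L g hKL
  have hφ : Function.Injective φ := by
    rw [injective_iff_map_eq_zero]
    intro q hq
    obtain ⟨u, rfl⟩ := J.mkQ_surjective q
    have hu : f u ∈ K := (Submodule.Quotient.mk_eq_zero K).1 hq
    obtain ⟨⟨x, y⟩, h⟩ := hu
    have h' : f x + σ y = f u := h
    have hy : (y : W) = 0 := by
      have := congrArg g h'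
      rwa [map_add, hgf, hσ', zero_add, hgf] at this
    have hy0 : y = 0 := Subtype.ext hy
    subst hy0
    rw [map_zero, add_zero] at h'
    refine (Submodule.Quotient.mk_eq_zero J).2 ?_
    rw [← hf h']
    exact x.2
  have hψ : Function.Surjective ψ := by
    intro q
    obtain ⟨w, rfl⟩ := L.mkQ_surjective q
    obtain ⟨v, rfl⟩ := hg w
    exact ⟨K.mkQ v, rfl⟩
  have hφψ : Function.Exact φ ψ := by
    intro q
    obtain ⟨v, rfl⟩ := K.mkQ_surjective q
    constructor
    · intro h
      have hv : g v ∈ L := (Submodule.Quotient.mk_eq_zero L).1 h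
      have h0 : g (v - σ ⟨g v, hv⟩) = 0 := by rw [map_sub, hσ', sub_self]
      obtain ⟨u, hu⟩ := (hfg _).1 h0
      refine ⟨J.mkQ u, ?_⟩
      change K.mkQ (f u) = K.mkQ v
      rw [hu, map_sub, sub_eq_self]
      exact (Submodule.Quotient.mk_eq_zero K).2 ⟨(0, ⟨g v, hv⟩), by simp [j]⟩
    · rintro ⟨q, hq⟩
      obtain ⟨u, rfl⟩ := J.mkQ_surjective q
      rw [← hq]
      change L.mkQ (g (f u)) = 0
      rw [hgf, map_zero]
  let φk := φ.restrictScalars k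
  let ψk := ψ.restrictScalars k
  have hex : LinearMap.ker ψk = LinearMap.range φk := by
    ext x
    exact hφψ x
  have hfd : FiniteDimensional k (V ⧸ K) := by
    have h1 : FiniteDimensional k (LinearMap.ker ψk) := by rw [hex]; infer_instance
    have h2 : FiniteDimensional k (LinearMap.range ψk) := inferInstance
    have h3 : FiniteDimensional k ((V ⧸ K) ⧸ LinearMap.ker ψk) :=
      Module.Finite.equiv ψk.quotKerEquivRange.symm
    exact Module.Finite.of_submodule_quotient (LinearMap.ker ψk)
  refine ⟨K, (hJ.prod hL).of_equiv (LinearEquiv.ofInjective j hj), hfd, ?_⟩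
  have hdim := ψk.finrank_range_add_finrank_ker
  rw [hex, LinearMap.finrank_range_of_inj (f := φk) hφ,
    LinearMap.range_eq_top.2 (show Function.Surjective ψk from hψ), finrank_top] at hdim
  rw [← hdim, add_comm]

theorem of_finiteDimensional (k H V : Type*) [Field k] [Ring H] [Algebra k H] [AddCommGroup V]
    [Module k V] [Module H V] [IsScalarTower k H V] [FiniteDimensional k V] :
    HasStableDim k H V (Module.finrank k V) :=
  ⟨⊥, Module.Baer.of_subsingleton _, inferInstance,
    ((Submodule.quotEquivOfEqBot (⊥ : Submodule H V) rfl).restrictScalars k).finrank_eq⟩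

end

end HasStableDim

theorem FiniteDimensional.of_ker_of_range {k V W : Type*} [Field k] [AddCommGroup V] [Module k V]
    [AddCommGroup W] [Module k W] (f : V →ₗ[k] W) [FiniteDimensional k (LinearMap.ker f)]
    [FiniteDimensional k (LinearMap.range f)] : FiniteDimensional k V := by
  have h3 : FiniteDimensional k (V ⧸ LinearMap.ker f) :=
    Module.Finite.equiv f.quotKerEquivRange.symm
  exact Module.Finite.of_submodule_quotient (LinearMap.ker f)

/-! ### Averaging with the integral, and existence of the stable dimension. -/

section

variable {k H : Type*} [Field k] [Ring H] [HopfAlgebra k H] {X V : Type*} [AddCommGroup X]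
  [Module k X] [AddCommGroup V] [Module k V] [Module H V] [IsScalarTower k H V]

/-- The bilinear map `(a, x) ↦ a • g x`. -/
noncomputable def smulMap (H : Type*) {k X V : Type*} [Field k] [Ring H] [Algebra k H]
    [AddCommGroup X] [Module k X] [AddCommGroup V] [Module k V] [Module H V] [IsScalarTower k H V]
    (g : X →ₗ[k] V) : H ⊗[k] X →ₗ[k] V :=
  TensorProduct.lift ((Algebra.lsmul k k V).toLinearMap.compl₂ g)

@[simp]
theorem smulMap_tmul (g : X →ₗ[k] V) (a : H) (x : X) : smulMap H g (a ⊗ₜ x) = a • g x := rfl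

/-- The `H`-linear map `φ ↦ ∑ Λ₁ • g (φ (S Λ₂))` out of a coinduced module. -/
noncomputable def Coinduced.integrate {Λ : H} (hΛ : IsLeftIntegral k Λ) (g : X →ₗ[k] V) :
    Coinduced k H X →ₗ[H] V where
  toFun φ := smulMap H g (TensorProduct.map LinearMap.id (eval φ) (HopfAlgebra.casimir k Λ))
  map_add' φ ψ := by rw [map_add, TensorProduct.map_add_right, LinearMap.add_apply, map_add]
  map_smul' h φ := by
    have h1 : ∀ x : H ⊗[k] H, TensorProduct.map LinearMap.id (eval (h • φ)) x =
        TensorProduct.map LinearMap.id (eval φ) (x * ((1 : H) ⊗ₜ h)) := by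
      intro x
      induction x with
      | zero => simp
      | add x y hx hy => simp only [map_add, add_mul, hx, hy]
      | tmul a b => simp [eval_smul]
    have h2 : ∀ x : H ⊗[k] H,
        smulMap H g (TensorProduct.map LinearMap.id (eval φ) ((h ⊗ₜ 1) * x)) =
        h • smulMap H g (TensorProduct.map LinearMap.id (eval φ) x) := by
      intro x
      induction x with
      | zero => simp
      | add x y hx hy => simp only [map_add, mul_add, smul_add, hx, hy]
      | tmul a b => simp [mul_smul]
    rw [h1, ← HopfAlgebra.mul_casimir hΛ, h2, RingHom.id_apply]

theorem Coinduced.integrate_coev [Module H X] [IsScalarTower k H X] {Λ : H}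
    (hΛ : IsLeftIntegral k Λ) (g : X →ₗ[k] V) (x : X) :
    integrate hΛ g (coev k x) =
      smulMap H g (TensorProduct.map LinearMap.id (actOn k H x) (HopfAlgebra.casimir k Λ)) := rfl

theorem smulMap_sum {ι : Type*} (s : Finset ι) (g : ι → X →ₗ[k] V) (y : H ⊗[k] X) :
    smulMap H (∑ i ∈ s, g i) y = ∑ i ∈ s, smulMap H (g i) y := by
  induction y with
  | zero => simp
  | add x y hx hy => simp only [map_add, hx, hy, Finset.sum_add_distrib]
  | tmul a b => simp [LinearMap.sum_apply, Finset.smul_sum]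

end

/-- `V` is a module over the `k`-algebra `R` and over the Hopf algebra `H` such that
`h • (r • v) = ∑ (h₁ • r) • (h₂ • v)`. -/
class HModuleCompatible (k H R V : Type*) [Field k] [Ring H] [Bialgebra k H]
    [Ring R] [Module H R] [AddCommGroup V] [Module H V] [Module R V] : Prop where
  smul_smul_repr : ∀ (h : H) (ρ : Coalgebra.Repr k h (H × H)) (r : R) (v : V),
    h • r • v = ∑ i ∈ ρ.index, (ρ.left i • r) • (ρ.right i • v)

section

variable {k H R : Type*} [Field k] [Ring H] [HopfAlgebra k H]
  [Ring R] [Algebra k R] [Module H R] [IsScalarTower k H R]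
  {V : Type*} [AddCommGroup V] [Module k V] [Module H V] [IsScalarTower k H V]
  [Module R V] [IsScalarTower k R V] [HModuleCompatible k H R V]


/-- Compatibility turns `∑ Λ₁ • (r • S(Λ₂) v)` into `∑ (Λ₁ • r) • (Λ₂ S(Λ₃) v)`, which
`lift_casimir` evaluates. This is how `ΛR` enters: multiplication by `Λ • r` is an average, so it
factors through a coinduced module. -/
theorem smulMap_casimir (Λ : H) (r : R) (v : V) :
    smulMap H (Algebra.lsmul k k V r) (TensorProduct.map LinearMap.id (actOn k H v)
      (HopfAlgebra.casimir k Λ)) = (Λ • r) • v := by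
  let f : H →ₗ[k] V →ₗ[k] V := (Algebra.lsmul k k V : R →ₐ[k] Module.End k V).toLinearMap ∘ₗ
    actOn k H r
  have key : ∀ y : H ⊗[k] V, smulMap H (Algebra.lsmul k k V r) y =
      TensorProduct.lift f (HopfAlgebra.galoisMap k H V y) := by
    intro y
    induction y with
    | zero => simp
    | add x y hx hy => simp only [map_add, hx, hy]
    | tmul a w =>
      have ρ := Coalgebra.Repr.arbitrary k a
      rw [smulMap_tmul, HopfAlgebra.galoisMap_tmul_repr ρ, map_sum]
      exact HModuleCompatible.smul_smul_repr (k := k) a ρ r w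
  rw [key, HopfAlgebra.lift_casimir]
  rfl

theorem Coinduced.integrate_coev_sum {X : Type*} [AddCommGroup X] [Module k X] [Module H X]
    [IsScalarTower k H X] {Λ : H} (hΛ : IsLeftIntegral k Λ) {ι : Type*} (s : Finset ι)
    (r : ι → R) (ξ : ι → X →ₗ[H] V) (x : X) :
    integrate hΛ (∑ i ∈ s, Algebra.lsmul k k V (r i) ∘ₗ (ξ i).restrictScalars k) (coev k x) =
      ∑ i ∈ s, (Λ • r i) • ξ i x := by
  rw [integrate_coev, smulMap_sum]
  refine Finset.sum_congr rfl fun i _ => ?_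
  rw [← smulMap_casimir (k := k)]
  generalize HopfAlgebra.casimir k Λ = y
  induction y with
  | zero => simp
  | add x y hx hy => simp only [map_add, hx, hy]
  | tmul a b => simp

variable [HModuleAlgebra k H R]

theorem smul_invariant_comm (h : H) (s : HInvariants k H R) (v : V) : h • s • v = s • h • v := by
  have ρ := Coalgebra.Repr.arbitrary k h
  change h • (s : R) • v = (s : R) • h • v
  rw [HModuleCompatible.smul_smul_repr (k := k) h ρ]
  simp only [s.2 _, smul_assoc]
  conv_rhs => rw [← Coalgebra.sum_counit_smul ρ, Finset.sum_smul, Finset.smul_sum]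
  refine Finset.sum_congr rfl fun i _ => ?_
  rw [smul_assoc, smul_comm (_ : k) (s : R)]

/-- The subspace of `V` annihilated by a left ideal. -/
def annihilatedBy (k : Type*) {H : Type*} [Field k] [Ring H] [Algebra k H] (V : Type*)
    [AddCommGroup V] [Module k V] [Module H V] [IsScalarTower k H V] (L : Ideal H) :
    Submodule k V where
  carrier := {v | ∀ h ∈ L, h • v = 0}
  add_mem' hv hw h hh := by rw [smul_add, hv h hh, hw h hh, add_zero]
  zero_mem' h _ := smul_zero h
  smul_mem' c v hv h hh := by rw [smul_comm, hv h hh, smul_zero]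

/-- The `R^H`-submodule of `V` annihilated by a left ideal of `H`. -/
def invariantsAnnihilatedBy (k : Type*) {H : Type*} (R V : Type*) [Field k] [Ring H]
    [HopfAlgebra k H] [Ring R] [Algebra k R] [Module H R] [IsScalarTower k H R]
    [HModuleAlgebra k H R] [AddCommGroup V] [Module k V] [Module H V] [IsScalarTower k H V]
    [Module R V] [IsScalarTower k R V] [HModuleCompatible k H R V] (L : Ideal H) :
    Submodule (HInvariants k H R) V where
  carrier := {v | ∀ h ∈ L, h • v = 0}
  add_mem' hv hw h hh := by rw [smul_add, hv h hh, hw h hh, add_zero]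
  zero_mem' h _ := smul_zero h
  smul_mem' c v hv h hh := by rw [smul_invariant_comm, hv h hh, smul_zero]

/-- The vectors of `V` killed by `L` are generated over `R^H` by finitely many `v i`. Modulo the
kernel of `q`, the part of the coefficients in `ΛR` contributes nothing, so a finite-dimensional
complement `C` of `ΛR` in `R^H` suffices. -/
theorem finiteDimensional_annihilatedBy_of_isMaximal [FiniteDimensional k H] {Λ : H}
    (hΛ : IsLeftIntegral k Λ) (hfin : FiniteDimensional k (InvariantsModImage k R Λ))
    [IsNoetherian (HInvariants k H R) V]
    {W : Type*} [AddCommGroup W] [Module k W] [Module H W] [IsScalarTower k H W]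
    (hW : ∀ N : Submodule H W, Module.Baer H N → N = ⊥) (q : V →ₗ[H] W) (c : W →ₗ[H] V)
    (hqc : ∀ w, q (c w) = w) (L : Ideal H) (hL : L.IsMaximal) :
    FiniteDimensional k (annihilatedBy k W L) := by
  obtain ⟨n, v, hv⟩ := Submodule.fg_iff_exists_fin_generating_family.1
    (IsNoetherian.noetherian (invariantsAnnihilatedBy k R V L))
  have hvL : ∀ i, ∀ h ∈ L, h • v i = 0 := fun i => by
    have : v i ∈ invariantsAnnihilatedBy k R V L := hv ▸ Submodule.subset_span ⟨i, rfl⟩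
    exact this
  let I := (smulImage k R Λ).submoduleOf (Subalgebra.toSubmodule (HInvariants k H R))
  obtain ⟨C, hC⟩ := I.exists_isCompl
  have hCfin : FiniteDimensional k C :=
    have : FiniteDimensional k (Subalgebra.toSubmodule (HInvariants k H R) ⧸ I) := hfin
    Module.Finite.equiv (I.quotientEquivOfIsCompl C hC)
  let D : (Fin n → C) →ₗ[k] W :=
    ∑ i, q.restrictScalars k ∘ₗ (Algebra.lsmul k k V : R →ₐ[k] _).toLinearMap.flip (v i) ∘ₗ
      (Subalgebra.toSubmodule (HInvariants k H R)).subtype ∘ₗ C.subtype ∘ₗ LinearMap.proj i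
  suffices annihilatedBy k W L ≤ LinearMap.range D from
    Submodule.finiteDimensional_of_le this
  intro w hw
  have hcw : c w ∈ Submodule.span (HInvariants k H R) (Set.range v) := by
    rw [hv]
    intro h hh
    rw [← map_smul, hw h hh, map_zero]
  obtain ⟨s, hs⟩ := (Submodule.mem_span_range_iff_exists_fun _).1 hcw
  have hdec : ∀ i, ∃ (r : R) (t : C), (s i : R) = Λ • r +
      ((t : Subalgebra.toSubmodule (HInvariants k H R)) : R) := by
    intro i
    obtain ⟨a, ha, b, hb, hab⟩ := Submodule.mem_sup.1
      (hC.sup_eq_top ▸ Submodule.mem_top (x := (s i : Subalgebra.toSubmodule (HInvariants k H R))))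
    obtain ⟨r, hr⟩ := ha
    refine ⟨r, ⟨b, hb⟩, ?_⟩
    rw [← hab]
    exact congrArg (· + (b : R)) hr.symm
  choose r t hrt using hdec
  have : IsSimpleModule H (H ⧸ L) := isSimpleModule_iff_isCoatom.2 hL.out
  -- Vectors killed by `L` correspond to maps out of the simple module `H ⧸ L`, with `v i` the image
  -- of the class of `1`.
  let ξ : Fin n → (H ⧸ L) →ₗ[H] V := fun i =>
    L.liftQ (LinearMap.toSpanSingleton H V (v i)) fun h hh => hvL i h hh
  let p := Coinduced.integrate hΛ
    (∑ i, Algebra.lsmul k k V (r i) ∘ₗ (ξ i).restrictScalars k : (H ⧸ L) →ₗ[k] V)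
  -- A map from a simple module is injective or zero. If injective, it would produce a nonzero
  -- injective submodule of `W`, because it factors through a coinduced module of finite length.
  have hzero : (q ∘ₗ p) ∘ₗ Coinduced.coev k = 0 := by
    rcases LinearMap.injective_or_eq_zero ((q ∘ₗ p) ∘ₗ Coinduced.coev (X := H ⧸ L) k) with h | h
    · have h1 : IsNoetherian H (Coinduced k H (H ⧸ L)) := isNoetherian_of_tower k inferInstance
      have h2 : IsArtinian H (Coinduced k H (H ⧸ L)) := isArtinian_of_tower k inferInstance
      have : Nontrivial (H ⧸ L) := IsSimpleModule.nontrivial H _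
      obtain ⟨N, hN, hN'⟩ := exists_baer_le_range Coinduced.baer (Coinduced.coev k) (q ∘ₗ p) h
      exact absurd (hW N hN') hN
    · exact h
  have hq : q (∑ i, (Λ • r i) • v i) = 0 := by
    have h1 := LinearMap.congr_fun hzero (L.mkQ 1)
    have h2 := Coinduced.integrate_coev_sum hΛ Finset.univ r ξ (L.mkQ 1)
    have h3 : ∀ i, ξ i (L.mkQ 1) = v i := fun i => one_smul H (v i)
    simp only [h3] at h2
    rw [← h2]
    exact h1
  refine ⟨t, ?_⟩
  rw [← hqc w, ← hs]
  have h4 : ∀ i, s i • v i = (Λ • r i) • v i + 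
      ((t i : Subalgebra.toSubmodule (HInvariants k H R)) : R) • v i := by
    intro i
    rw [← add_smul, ← hrt]
    rfl
  simp only [h4, Finset.sum_add_distrib]
  rw [map_add, hq, zero_add, map_sum]
  simp [D, LinearMap.sum_apply]

end

/-- Noetherian induction descends from `⊤` to `⊥` through the left ideals `N`. If `N'` covers `N`
and `y ∈ N' \ N`, then `L = {x | x y ∈ N}` is maximal. Acting by `y` maps the vectors killed by `N`
to those killed by `L`, with kernel inside those killed by `N'`. -/
theorem finiteDimensional_of_annihilatedBy {k H W : Type*} [Field k] [Ring H] [Algebra k H]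
    [FiniteDimensional k H] [AddCommGroup W] [Module k W] [Module H W] [IsScalarTower k H W]
    (h : ∀ L : Ideal H, L.IsMaximal → FiniteDimensional k (annihilatedBy k W L)) :
    FiniteDimensional k W := by
  have h1 : IsNoetherian H H := isNoetherian_of_tower k inferInstance
  have h2 : IsArtinian H H := isArtinian_of_tower k inferInstance
  have key : ∀ N : Ideal H, FiniteDimensional k (annihilatedBy k W N) := by
    intro N
    induction N using IsNoetherian.induction with
    | _ N ih =>
    by_cases hN : N = ⊤
    · have : annihilatedBy k W N = ⊥ := by
        rw [eq_bot_iff]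
        intro w hw
        have := hw 1 (hN ▸ Submodule.mem_top)
        rwa [one_smul] at this
      rw [this]
      infer_instance
    obtain ⟨N', hN'⟩ := exists_covBy_of_wellFoundedLT (a := N) (fun h => hN h.eq_top)
    obtain ⟨y, hy, hyN⟩ := SetLike.exists_of_lt hN'.lt
    let L : Ideal H := N.comap (LinearMap.toSpanSingleton H H y)
    have hmemL : ∀ x, x ∈ L ↔ x * y ∈ N := fun x => Iff.rfl
    have hgen : ∀ z ∈ N', z ∉ N → ∀ x ∈ N', ∃ a, x - a * z ∈ N := by
      intro z hz hzN x hx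
      have hsup : N ⊔ Submodule.span H {z} = N' := by
        refine (hN'.eq_or_eq le_sup_left (sup_le hN'.le ?_)).resolve_left ?_
        · rwa [Submodule.span_singleton_le_iff_mem]
        · intro h
          exact hzN (h ▸ le_sup_right (a := N) (Submodule.mem_span_singleton_self z))
      rw [← hsup] at hx
      obtain ⟨b, hb, w, hw, rfl⟩ := Submodule.mem_sup.1 hx
      obtain ⟨a, rfl⟩ := Submodule.mem_span_singleton.1 hw
      exact ⟨a, by simpa using hb⟩
    have hL : L.IsMaximal := by
      refine ⟨⟨fun h => hyN ?_, fun L' hLL' => ?_⟩⟩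
      · have := (hmemL 1).1 (h ▸ Submodule.mem_top)
        rwa [one_mul] at this
      · obtain ⟨x, hx, hxL⟩ := SetLike.exists_of_lt hLL'
        obtain ⟨a, ha⟩ := hgen (x * y) (Ideal.mul_mem_left N' x hy) (fun h => hxL ((hmemL x).2 h)) y hy
        rw [Ideal.eq_top_iff_one]
        have h3 : 1 - a * x ∈ L := (hmemL _).2 (by rwa [sub_mul, one_mul, mul_assoc])
        have := L'.add_mem (hLL'.le h3) (L'.mul_mem_left a hx)
        rwa [sub_add_cancel] at this
    let f : annihilatedBy k W N →ₗ[k] annihilatedBy k W L :=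
      ((Algebra.lsmul k k W y).comp (annihilatedBy k W N).subtype).codRestrict _ fun w x hx => by
        change x • y • (w : W) = 0
        rw [smul_smul]
        exact w.2 _ ((hmemL x).1 hx)
    have hLf := h L hL
    have hN'f := ih N' hN'.lt
    have hker : FiniteDimensional k (LinearMap.ker f) := by
      let i : LinearMap.ker f →ₗ[k] annihilatedBy k W N' :=
        ((annihilatedBy k W N).subtype ∘ₗ (LinearMap.ker f).subtype).codRestrict _ fun w x hx => by
          obtain ⟨a, ha⟩ := hgen y hy hyN x hx
          have h3 : y • ((w : annihilatedBy k W N) : W) = 0 := congrArg Subtype.val w.2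
          have h4 := (w : annihilatedBy k W N).2 _ ha
          rw [sub_smul, mul_smul, h3, smul_zero, sub_zero] at h4
          exact h4
      refine Module.Finite.of_injective i fun a b hab => ?_
      exact Subtype.ext (Subtype.ext (congrArg (Subtype.val : annihilatedBy k W N' → W) hab))
    have hrange : FiniteDimensional k (LinearMap.range f) :=
      FiniteDimensional.finiteDimensional_submodule _
    exact FiniteDimensional.of_ker_of_range f
  have htop : annihilatedBy k W (⊥ : Ideal H) = ⊤ := by
    rw [eq_top_iff]
    intro w _ x hx
    rw [(Submodule.mem_bot H).1 hx, zero_smul]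
  have := key ⊥
  rw [htop] at this
  exact Module.Finite.equiv (Submodule.topEquiv (R := k) (M := W))

theorem exists_hasStableDim {k H R : Type*} [Field k] [Ring H] [HopfAlgebra k H]
    [FiniteDimensional k H]
    [Ring R] [Algebra k R] [Module H R] [IsScalarTower k H R] [HModuleAlgebra k H R]
    {Λ : H} (hΛ : IsLeftIntegral k Λ) (hR : IsNoetherian (HInvariants k H R) R)
    (hfin : FiniteDimensional k (InvariantsModImage k R Λ))
    {V : Type*} [AddCommGroup V] [Module k V] [Module H V] [IsScalarTower k H V]
    [Module R V] [IsScalarTower k R V] [HModuleCompatible k H R V] [Module.Finite R V] :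
    ∃ d, HasStableDim k H V d := by
  have h1 : IsNoetherian H H := isNoetherian_of_tower k inferInstance
  have hV : IsNoetherian (HInvariants k H R) V := by
    obtain ⟨n, f, hf⟩ := Module.Finite.exists_fin' R V
    exact isNoetherian_of_surjective (f.restrictScalars (HInvariants k H R))
      (LinearMap.range_eq_top.2 hf)
  obtain ⟨J, hJ⟩ := exists_maximal_baer H V
  obtain ⟨e, he⟩ := hJ.prop.exists_equiv_prod
  let c : (V ⧸ J) →ₗ[H] V := e.symm.toLinearMap ∘ₗ LinearMap.inl H _ _
  have hc : ∀ w, J.mkQ (c w) = w := fun w => by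
    rw [← he]
    exact congrArg Prod.fst (e.apply_symm_apply (w, 0))
  have hJ0 : ∀ x : J, J.mkQ (x : V) = 0 := fun x => by simp
  -- Through the section `c`, an injective submodule `N` of `V ⧸ J` would enlarge `J` to the
  -- injective submodule `J ⊕ c(N)`, so maximality forces `N = ⊥`.
  have hW : ∀ N : Submodule H (V ⧸ J), Module.Baer H N → N = ⊥ := by
    intro N hN
    let j : J × N →ₗ[H] V := J.subtype.coprod (c ∘ₗ N.subtype)
    have hj : Function.Injective j := by
      rw [injective_iff_map_eq_zero]
      rintro ⟨x, y⟩ h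
      have h' : (x : V) + c y = 0 := h
      have hy : y = 0 := Subtype.ext (by
        have := congrArg J.mkQ h'
        rwa [map_add, hJ0, hc, zero_add, map_zero] at this)
      subst hy
      have hx : x = 0 := Subtype.ext (by simpa using h')
      subst hx
      rfl
    have hle : LinearMap.range j ≤ J := hJ.le_of_ge
      ((hJ.prop.prod hN).of_equiv (LinearEquiv.ofInjective j hj))
      (fun x hx => ⟨(⟨x, hx⟩, 0), by simp [j]⟩)
    rw [eq_bot_iff]
    intro y hy
    have h2 : c y ∈ J := hle ⟨(0, ⟨y, hy⟩), by simp [j]⟩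
    rw [Submodule.mem_bot, ← hc y]
    exact hJ0 ⟨_, h2⟩
  refine ⟨_, J, hJ.prop, finiteDimensional_of_annihilatedBy fun L hL =>
    finiteDimensional_annihilatedBy_of_isMaximal hΛ hfin hW J.mkQ c hc L hL, rfl⟩

/-! ### Restricting modules over the smash product to `R` and to `H`. -/

namespace SmashProduct

variable {k : Type uk} {R : Type uR} {H : Type uH} [Field k] [Ring H] [HopfAlgebra k H]
  [Ring R] [Algebra k R] [Module H R] [IsScalarTower k H R] [HModuleAlgebra k H R]

theorem mk_mul_mk_one (r r' : R) (h' : H) :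
    (mk r 1 * mk r' h' : SmashProduct k R H) = mk (r * r') h' := by
  change mulMap (r ⊗ₜ[k] (1 : H)) (r' ⊗ₜ[k] h') = (r * r') ⊗ₜ[k] h'
  rw [mulMap_tmul, twist, LinearMap.comp_apply, Bialgebra.comul_one,
    Algebra.TensorProduct.one_def, TensorProduct.map_tmul, sandwich_tmul]
  simp

theorem mk_one_mul_mk_one (h h' : H) :
    (mk 1 h * mk 1 h' : SmashProduct k R H) = mk 1 (h * h') := by
  have ρ := Coalgebra.Repr.arbitrary k h
  rw [mk_mul_mk _ _ _ _ ρ]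
  change ∑ i ∈ ρ.index, (1 * (ρ.left i • (1 : R))) ⊗ₜ[k] (ρ.right i * h') = 1 ⊗ₜ[k] (h * h')
  simp only [HModuleAlgebra.smul_one' (k := k), one_mul, TensorProduct.smul_tmul,
    ← TensorProduct.tmul_sum, ← smul_mul_assoc, ← Finset.sum_mul, Coalgebra.sum_counit_smul]

/-- The embedding of `R` into `R # H`. -/
noncomputable def inclLeft (k : Type uk) (R : Type uR) (H : Type uH) [Field k] [Ring H]
    [HopfAlgebra k H] [Ring R] [Algebra k R] [Module H R] [IsScalarTower k H R]
    [HModuleAlgebra k H R] : R →ₐ[k] SmashProduct k R H :=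
  AlgHom.ofLinearMap ((TensorProduct.mk k R H).flip 1) rfl
    fun r s => (mk_mul_mk_one r s 1).symm

/-- The embedding of `H` into `R # H`. -/
noncomputable def inclRight (k : Type uk) (R : Type uR) (H : Type uH) [Field k] [Ring H]
    [HopfAlgebra k H] [Ring R] [Algebra k R] [Module H R] [IsScalarTower k H R]
    [HModuleAlgebra k H R] : H →ₐ[k] SmashProduct k R H :=
  AlgHom.ofLinearMap (TensorProduct.mk k R H 1) rfl
    fun r s => (mk_one_mul_mk_one r s).symm

theorem inclRight_mul_inclLeft (h : H) (r : R) {ι : Type*} (ρ : Coalgebra.Repr k h ι) :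
    inclRight k R H h * inclLeft k R H r =
      ∑ i ∈ ρ.index, inclLeft k R H (ρ.left i • r) * inclRight k R H (ρ.right i) := by
  refine (mk_mul_mk 1 r h 1 ρ).trans (Finset.sum_congr rfl fun i _ => ?_)
  refine Eq.trans ?_ (mk_mul_mk_one _ _ _).symm
  rw [one_mul, mul_one, mul_one]

theorem mk_eq_mul (r : R) (h : H) :
    (mk r h : SmashProduct k R H) = inclLeft k R H r * inclRight k R H h := by
  refine Eq.trans ?_ (mk_mul_mk_one _ _ _).symm
  rw [mul_one]

/-- The restriction of an `R # H`-module to `H`. -/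
@[reducible]
noncomputable def moduleRight (k : Type uk) (R : Type uR) (H : Type uH) [Field k] [Ring H]
    [HopfAlgebra k H] [Ring R] [Algebra k R] [Module H R] [IsScalarTower k H R]
    [HModuleAlgebra k H R] (V : Type*) [AddCommGroup V] [Module (SmashProduct k R H) V] :
    Module H V :=
  Module.compHom V (inclRight k R H).toRingHom

/-- The restriction of an `R # H`-module to `R`. -/
@[reducible]
noncomputable def moduleLeft (k : Type uk) (R : Type uR) (H : Type uH) [Field k] [Ring H]
    [HopfAlgebra k H] [Ring R] [Algebra k R] [Module H R] [IsScalarTower k H R]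
    [HModuleAlgebra k H R] (V : Type*) [AddCommGroup V] [Module (SmashProduct k R H) V] :
    Module R V :=
  Module.compHom V (inclLeft k R H).toRingHom

theorem hModuleCompatible (V : Type*) [AddCommGroup V] [Module (SmashProduct k R H) V] :
    let := moduleRight k R H V
    let := moduleLeft k R H V
    HModuleCompatible k H R V := by
  let := moduleRight k R H V
  let := moduleLeft k R H V
  refine ⟨fun h ρ r v => ?_⟩
  change inclRight k R H h • inclLeft k R H r • v =
    ∑ i ∈ ρ.index, inclLeft k R H (ρ.left i • r) • inclRight k R H (ρ.right i) • v
  rw [smul_smul, inclRight_mul_inclLeft h r ρ, Finset.sum_smul]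
  simp only [mul_smul]

variable (V : Type*) [AddCommGroup V] [Module k V] [Module (SmashProduct k R H) V]
  [IsScalarTower k (SmashProduct k R H) V]

theorem isScalarTower_right : letI := moduleRight k R H V; IsScalarTower k H V := by
  let := moduleRight k R H V
  refine ⟨fun c h v => ?_⟩
  change inclRight k R H (c • h) • v = c • inclRight k R H h • v
  rw [map_smul, smul_assoc]

theorem isScalarTower_left : letI := moduleLeft k R H V; IsScalarTower k R V := by
  let := moduleLeft k R H V
  refine ⟨fun c h v => ?_⟩
  change inclLeft k R H (c • h) • v = c • inclLeft k R H h • v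
  rw [map_smul, smul_assoc]

/-- Since `r # h = (r # 1)(1 # h)`, multiplying `T`-generators of `V` by a finite spanning set of
`H` gives generators over `R`. -/
theorem finite_left [FiniteDimensional k H] [Module.Finite (SmashProduct k R H) V] :
    let := moduleLeft k R H V; Module.Finite R V := by
  classical
  let := moduleLeft k R H V
  have := isScalarTower_left (k := k) (R := R) (H := H) V
  obtain ⟨s, hs⟩ := Module.Finite.fg_top (R := SmashProduct k R H) (M := V)
  obtain ⟨t, ht⟩ := Module.Finite.fg_top (R := k) (M := H)
  let N : Submodule R V := Submodule.span R
    (((t ×ˢ s).image fun p => inclRight k R H p.1 • p.2 : Finset V) : Set V)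
  have hN : ∀ v ∈ s, ∀ h : H, inclRight k R H h • v ∈ N := by
    intro v hv h
    have hh : h ∈ Submodule.span k (t : Set H) := ht ▸ Submodule.mem_top
    induction hh using Submodule.span_induction with
    | mem x hx =>
      exact Submodule.subset_span (Finset.mem_coe.2 (Finset.mem_image_of_mem
        (fun p : H × V => inclRight k R H p.1 • p.2) (Finset.mk_mem_product hx hv)))
    | zero => simp
    | add x y _ _ hx hy => rw [map_add, add_smul]; exact N.add_mem hx hy
    | smul c x _ hx =>
      rw [map_smul, smul_assoc]
      exact N.smul_of_tower_mem c hx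
  have hN' : ∀ v ∈ s, ∀ x : SmashProduct k R H, x • v ∈ N := by
    intro v hv x
    induction x using TensorProduct.induction_on with
    | zero => exact (zero_smul (SmashProduct k R H) v).symm ▸ N.zero_mem
    | add x y hx hy => exact (add_smul (R := SmashProduct k R H) x y v).symm ▸ N.add_mem hx hy
    | tmul r h =>
      have h1 : (mk r h : SmashProduct k R H) • v = r • inclRight k R H h • v := by
        rw [mk_eq_mul, mul_smul]; rfl
      exact h1.symm ▸ N.smul_mem r (hN v hv h)
  refine ⟨⟨(t ×ˢ s).image fun p => inclRight k R H p.1 • p.2, eq_top_iff.2 fun v _ => ?_⟩⟩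
  have hv : v ∈ Submodule.span (SmashProduct k R H) (s : Set V) := hs ▸ Submodule.mem_top
  obtain ⟨f, -, rfl⟩ := Submodule.mem_span_finset.1 hv
  exact N.sum_mem fun x hx => hN' x hx _

end SmashProduct

/-! ### The stable dimension on the Grothendieck group, and the theorem. -/

namespace G0

open SmashProduct

variable {k : Type uk} {R : Type uR} {H : Type uH} [Field k] [Ring H] [HopfAlgebra k H]
  [Ring R] [Algebra k R] [Module H R] [IsScalarTower k H R] [HModuleAlgebra k H R]

/-- The underlying `H`-module of the `R # H`-module `V` is the direct sum of an injective module
and a module of dimension `d`. -/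
def RestrictionHasStableDim (k : Type uk) (R : Type uR) (H : Type uH) [Field k] [Ring H]
    [HopfAlgebra k H] [Ring R] [Algebra k R] [Module H R] [IsScalarTower k H R]
    [HModuleAlgebra k H R] (V : Type*) [AddCommGroup V] [Module (SmashProduct k R H) V] (d : ℕ) :
    Prop :=
  letI := Module.compHom V (algebraMap k (SmashProduct k R H))
  haveI : IsScalarTower k (SmashProduct k R H) V := ⟨fun c x v => by
    rw [Algebra.smul_def, mul_smul]; rfl⟩
  letI := moduleRight k R H V
  haveI := isScalarTower_right (k := k) (R := R) (H := H) V
  HasStableDim k H V d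

/-- Objects of `FGModuleCat` carry only the `T`-action, so their `k`-structure is pulled back along
`algebraMap`. Any compatible `k`-structure equals that one. -/
theorem restrictionHasStableDim_iff (V : Type*) [AddCommGroup V] [m : Module k V]
    [Module (SmashProduct k R H) V] [IsScalarTower k (SmashProduct k R H) V] (d : ℕ) :
    let := moduleRight k R H V
    have := isScalarTower_right (k := k) (R := R) (H := H) V
    RestrictionHasStableDim k R H V d ↔ HasStableDim k H V d := by
  have : m = Module.compHom V (algebraMap k (SmashProduct k R H)) :=
    Module.ext' _ _ fun c v => (algebraMap_smul (SmashProduct k R H) c v).symm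
  subst this
  rfl

/-- The dimension modulo `δ` of finite-dimensional modules extends to a homomorphism on `G₀(R # H)`,
the stable dimension. -/
theorem exists_stableDim [FiniteDimensional k H] {Λ : H} (hΛ₀ : Λ ≠ 0)
    (hΛ : IsLeftIntegral k Λ) (hR : IsNoetherian (HInvariants k H R) R)
    (hfin : FiniteDimensional k (InvariantsModImage k R Λ)) :
    ∃ φ : G0 (SmashProduct k R H) →+ ZMod (projDimGCD k H),
      ∀ (M : Type (max uR uH)) [AddCommGroup M] [Module k M] [Module (SmashProduct k R H) M]
        [IsScalarTower k (SmashProduct k R H) M] [FiniteDimensional k M]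
        (hM : Module.Finite (SmashProduct k R H) M),
        φ (cls (SmashProduct k R H) M hM) = Module.finrank k M := by
  have hex : ∀ V : FGModuleCat.{max uR uH} (SmashProduct k R H),
      ∃ d, RestrictionHasStableDim k R H V d := by
    intro V
    let := Module.compHom V (algebraMap k (SmashProduct k R H))
    have : IsScalarTower k (SmashProduct k R H) V := ⟨fun c x v => by
      rw [Algebra.smul_def, mul_smul]; rfl⟩
    let := moduleRight k R H V
    let := moduleLeft k R H V
    have := isScalarTower_right (k := k) (R := R) (H := H) V
    have := isScalarTower_left (k := k) (R := R) (H := H) V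
    have := hModuleCompatible (k := k) (R := R) (H := H) V
    have := finite_left (k := k) (R := R) (H := H) V
    exact exists_hasStableDim hΛ hR hfin
  choose D hD using hex
  have huniq : ∀ (V : Type (max uR uH)) [AddCommGroup V] [Module (SmashProduct k R H) V] (a b : ℕ),
      RestrictionHasStableDim k R H V a → RestrictionHasStableDim k R H V b →
      (a : ZMod (projDimGCD k H)) = b := by
    intro V _ _ a b ha hb
    let := Module.compHom V (algebraMap k (SmashProduct k R H))
    have : IsScalarTower k (SmashProduct k R H) V := ⟨fun c x v => by
      rw [Algebra.smul_def, mul_smul]; rfl⟩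
    let := moduleRight k R H V
    have := isScalarTower_right (k := k) (R := R) (H := H) V
    exact HasStableDim.natCast_eq hΛ₀ hΛ ha hb
  let φ₀ : FreeAbelianGroup (FGModuleCat.{max uR uH} (SmashProduct k R H)) →+
      ZMod (projDimGCD k H) := FreeAbelianGroup.lift fun V => (D V : ZMod (projDimGCD k H))
  have hφ₀ : AddSubgroup.closure (G0Relations (SmashProduct k R H)) ≤ φ₀.ker := by
    rw [AddSubgroup.closure_le]
    rintro _ ⟨U, V, W, f, g, hf, hfg, hg, rfl⟩
    have key : RestrictionHasStableDim k R H V (D U + D W) := by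
      have hU := hD U
      have hW := hD W
      let := Module.compHom U (algebraMap k (SmashProduct k R H))
      let := Module.compHom V (algebraMap k (SmashProduct k R H))
      let := Module.compHom W (algebraMap k (SmashProduct k R H))
      have : IsScalarTower k (SmashProduct k R H) U := ⟨fun c x v => by
        rw [Algebra.smul_def, mul_smul]; rfl⟩
      have : IsScalarTower k (SmashProduct k R H) V := ⟨fun c x v => by
        rw [Algebra.smul_def, mul_smul]; rfl⟩
      have : IsScalarTower k (SmashProduct k R H) W := ⟨fun c x v => by
        rw [Algebra.smul_def, mul_smul]; rfl⟩
      let := moduleRight k R H U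
      let := moduleRight k R H V
      let := moduleRight k R H W
      have := isScalarTower_right (k := k) (R := R) (H := H) U
      have := isScalarTower_right (k := k) (R := R) (H := H) V
      have := isScalarTower_right (k := k) (R := R) (H := H) W
      let f' : U →ₗ[H] V := { f with map_smul' := fun h u => f.map_smul (inclRight k R H h) u }
      let g' : V →ₗ[H] W := { g with map_smul' := fun h u => g.map_smul (inclRight k R H h) u }
      exact HasStableDim.of_exact hΛ₀ hΛ f' g' hf hfg hg hU hW
    have h1 := huniq V _ _ (hD V) key
    change φ₀ _ = 0
    simp only [φ₀, map_sub, FreeAbelianGroup.lift_apply_of]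
    rw [h1, Nat.cast_add]
    abel
  refine ⟨QuotientAddGroup.lift _ φ₀ hφ₀, fun M _ _ _ _ _ hM => ?_⟩
  have h1 : (D (FGModuleCat.of (SmashProduct k R H) M) : ZMod (projDimGCD k H)) =
      Module.finrank k M := by
    -- A finite-dimensional `M` also splits with injective part `⊥`, so its stable dimension is `dim
    -- M` modulo `δ`.
    refine huniq M _ _ (hD (FGModuleCat.of (SmashProduct k R H) M)) ?_
    refine (restrictionHasStableDim_iff M _).2 ?_
    let := moduleRight k R H M
    have := isScalarTower_right (k := k) (R := R) (H := H) M
    exact HasStableDim.of_finiteDimensional k H M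
  rw [← h1]
  exact FreeAbelianGroup.lift_apply_of _ _

end G0

theorem corollary3p3 {k : Type uk} {H : Type uH} {R : Type uR}
    [Field k]
    -- `H` is a finite-dimensional Hopf algebra over `k`
    [Ring H] [HopfAlgebra k H] [FiniteDimensional k H]
    -- `R` is a left `H`-module algebra
    [Ring R] [Algebra k R] [Module H R] [IsScalarTower k H R] [HModuleAlgebra k H R]
    -- `Λ` is a nonzero left integral of `H`
    (Λ : H) (hΛ₀ : Λ ≠ 0) (hΛ : IsLeftIntegral k Λ)
    -- `R` is noetherian as a left module over `R^H`
    (hR : IsNoetherian (HInvariants k H R) R)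
    -- `R^H / Λ R` is finite-dimensional
    (hfin : FiniteDimensional k (InvariantsModImage k R Λ))
    -- `M` is a left module over `T = R # H` that is finite-dimensional over `k`
    (M : Type (max uR uH)) [AddCommGroup M] [Module k M] [Module (SmashProduct k R H) M]
    [IsScalarTower k (SmashProduct k R H) M] [FiniteDimensional k M] :
    projDimGCD k H / Nat.gcd (projDimGCD k H) (Module.finrank k M) ∣
      addOrderOf (G0.cls (SmashProduct k R H) M
        (Module.Finite.of_restrictScalars_finite k (SmashProduct k R H) M)) := by
  obtain ⟨φ, hφ⟩ := G0.exists_stableDim hΛ₀ hΛ hR hfin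
  have hM := Module.Finite.of_restrictScalars_finite k (SmashProduct k R H) M
  -- If `[M]` has infinite order, `addOrderOf` is `0`, which every integer divides; the argument
  -- covers this case unchanged.
  have h1 := congrArg φ (addOrderOf_nsmul_eq_zero (G0.cls (SmashProduct k R H) M hM))
  rw [map_nsmul, hφ M, map_zero, nsmul_eq_mul, ← Nat.cast_mul, ZMod.natCast_eq_zero_iff] at h1
  have hH : Nontrivial H := ⟨Λ, 0, hΛ₀⟩
  -- `δ` divides `dim H > 0`, so the gcd is positive even when `M = 0`.
  have h0 : 0 < Nat.gcd (projDimGCD k H) (Module.finrank k M) :=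
    Nat.gcd_pos_of_pos_left _ (Nat.pos_of_dvd_of_pos (projDimGCD_dvd_finrank k H H)
      Module.finrank_pos)
  refine (Nat.coprime_div_gcd_div_gcd h0).dvd_of_dvd_mul_right ?_
  obtain ⟨c, hc⟩ := h1
  refine ⟨c, Nat.eq_of_mul_eq_mul_right h0 ?_⟩
  rw [mul_assoc, Nat.div_mul_cancel (Nat.gcd_dvd_right _ _), hc, mul_right_comm,
    Nat.div_mul_cancel (Nat.gcd_dvd_left _ _)]
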